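/- Let $A$ be a unital complex Banach algebra and let $\Psi=\{\psi_t\}_{t\in\mathbb R^d}$ be a group of algebra automorphisms of $A$ with $\psi_{s+t}=\psi_s\psi_t$ and $\sup_t\|\psi_t\|<\infty$ (no continuity in $t$ is assumed) that is periodic, i.e. $\psi_{t+e_j}=\psi_t$ for all $t$ and $1\le j\le d$. Let $\delta_j(a)=\lim_{h\to0}(\psi_{he_j}(a)-a)/h$ be its generators, let $C(A)=\{a:\lim_{t\to0}\psi_t(a)=a\}$, let $C^\infty(A)$ be the set of all $a\in A$ to which every product of the $\delta_j$ can be applied, and put $\hat a(k)=\int_{[0,1]^d}\psi_t(a)e^{-2\pi i k\cdot t}\,dt$ for $a\in C(A)$, $k\in\mathbb Z^d$. Let $M=(M_k)_{k\ge0}$ be a sequence of positive numbers with $M_0=1$ that satisfies Komatsu's condition (M2') there are $c>0$ and $h>1$ with $M_{k+1}\le c\,h^kM_k$ for all $k$. Put $T_M(u)=\sup_{k\ge0}u^k/M_k\in[0,\infty]$ for $u\ge 0$ (with $0^0=1$), $T_{r,M}(k)=T_M(2\pi|k|_\infty/r)$ for $k\in\mathbb Z^d$ and $T_{r,M}(n)=T_M(2\pi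 n/r)$ for $n\in\mathbb N_0$. For $r>0$ consider the following spaces, each consisting of the elements with finite norm (with $0\cdot\infty=0$): * $C_{r,M}(A)$: all $a\in C^\infty(A)$, with norm $\sup_{\alpha\in\mathbb N_0^d}\|\delta^\alpha(a)\|/(r^{|\alpha|}M_{|\alpha|})$; * $\mathcal C^1_{T_{r,M}}(A)$: all $a\in C(A)$, with norm $\sum_{k\in\mathbb Z^d}\|\hat a(k)\|\,T_{r,M}(k)$; * $\mathcal C^\infty_{T_{r,M}}(A)$: all $a\in C(A)$, with norm $\sup_{k\in\mathbb Z^d}\|\hat a(k)\|\,T_{r,M}(k)$; * $\mathcal E^\infty_{T_{r,M}}(A)$: all $a\in A$, with norm $\sup_{n\ge0}E_n(a)\,T_{r,M}(n)$, where $E_n(a)=\inf_{x\in X_n}\|a-x\|$, $X_0=\{0\}$ and, for $n\ge1$, $X_n$ is the space of $n$-bandlimited elements, i.e. of all $a\in C^\infty(A)$ for which there is a $C$ with $\|\delta^\alpha(a)\|\le C(2\pi n)^{|\alpha|}$ for all $\alpha\in\mathbb N_0^d$. Let $C_M(A)=\bigcup_{r>0}C_{r,M}(A)$. Then $C_M(A)$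 is a unital subalgebra of $A$ and $$C_M(A)=\bigcup_{r>0}\mathcal C^1_{T_{r,M}}(A)=\bigcup_{r>0}\mathcal C^\infty_{T_{r,M}}(A),$$ and if moreover there is an $\varepsilon>0$ with $M_k\ge\varepsilon^k$ for all $k$ (equivalently, $\liminf_{k\to\infty}M_k^{1/k}>0$), then also $$C_M(A)=\bigcup_{r>0}\mathcal E^\infty_{T_{r,M}}(A).$$ In each case the identity map is a topological isomorphism when the unions carry their locally convex inductive limit topologies. -/

import Mathlib

open Filter Topology MeasureTheory
open scoped ENNReal

noncomputable section

namespace Carleman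

/-! ### Extended norms and locally convex inductive limits -/

section IndLim

/-- An extended norm functional on a complex vector space `A`: a subadditive, homogeneous function
with values in `[0, ∞]`. The associated normed space consists of the `a` with finite value. -/
structure ExtNorm (A : Type*) [AddCommGroup A] [Module ℂ A] where
  toFun : A → ℝ≥0∞
  add_le : ∀ a b, toFun (a + b) ≤ toFun a + toFun b
  smul_le : ∀ (c : ℂ) a, toFun (c • a) ≤ ‖c‖ₑ * toFun a

namespace ExtNorm

variable {A : Type*} [AddCommGroup A] [Module ℂ A]

theorem map_zero (N : ExtNorm A) : N.toFun 0 = 0 := by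
  have h := N.smul_le 0 0
  simpa using h

/-- The space of all `a` with `N a < ∞`. -/
def space (N : ExtNorm A) : Submodule ℂ A where
  carrier := {a | N.toFun a < ∞}
  add_mem' {a b} ha hb := (N.add_le a b).trans_lt (ENNReal.add_lt_top.2 ⟨ha, hb⟩)
  zero_mem' := by simp [N.map_zero]
  smul_mem' c a ha := (N.smul_le c a).trans_lt (ENNReal.mul_lt_top enorm_lt_top ha)

/-- The (finite) norm on `N.space`. -/
def norm (N : ExtNorm A) : Seminorm ℂ N.space :=
  Seminorm.ofSMulLE (fun a => (N.toFun a).toReal) (by simp [N.map_zero])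
    (fun a b => by
      rw [← ENNReal.toReal_add a.2.ne b.2.ne]
      exact ENNReal.toReal_mono (ENNReal.add_lt_top.2 ⟨a.2, b.2⟩).ne (N.add_le a b))
    (fun c a => by
      have h := ENNReal.toReal_mono (ENNReal.mul_lt_top (enorm_lt_top (x := c)) a.2).ne
        (N.smul_le c a)
      simpa [ENNReal.toReal_mul] using h)

/-- The norm topology of `N.space`; it is in general not the subspace topology. -/
abbrev topology (N : ExtNorm A) : TopologicalSpace N.space :=
  N.norm.toSeminormedAddCommGroup.toUniformSpace.toTopologicalSpace

end ExtNorm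

/-- An increasing scale of normed spaces, indexed by `r > 0`. -/
structure Scale (A : Type*) [AddCommGroup A] [Module ℂ A] where
  extNorm : ℝ → ExtNorm A
  anti : ∀ r s, 0 < r → r ≤ s → ∀ a, (extNorm s).toFun a ≤ (extNorm r).toFun a

namespace Scale

variable {A : Type*} [AddCommGroup A] [Module ℂ A]

/-- The union over all `r > 0` of the spaces of the scale. -/
def union (S : Scale A) : Submodule ℂ A where
  carrier := ⋃ r : Set.Ioi (0 : ℝ), ((S.extNorm r).space : Set A)
  add_mem' {a b} ha hb := by
    obtain ⟨⟨r, hr⟩, ha⟩ := Set.mem_iUnion.1 ha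
    obtain ⟨⟨s, hs⟩, hb⟩ := Set.mem_iUnion.1 hb
    have hr' : (0 : ℝ) < r := hr
    have hs' : (0 : ℝ) < s := hs
    refine Set.mem_iUnion.2 ⟨⟨max r s, lt_max_of_lt_left hr'⟩, ?_⟩
    exact (S.extNorm (max r s)).space.add_mem
      ((S.anti r _ hr' (le_max_left r s) a).trans_lt ha)
      ((S.anti s _ hs' (le_max_right r s) b).trans_lt hb)
  zero_mem' := Set.mem_iUnion.2 ⟨⟨1, Set.mem_Ioi.2 one_pos⟩, (S.extNorm 1).space.zero_mem⟩
  smul_mem' c a ha := by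
    obtain ⟨r, ha⟩ := Set.mem_iUnion.1 ha
    exact Set.mem_iUnion.2 ⟨r, (S.extNorm r).space.smul_mem c ha⟩

/-- The union of the scale as a type of its own, to be given the inductive limit topology (and
not the subspace topology). -/
def Lim (S : Scale A) : Type _ := S.union

instance (S : Scale A) : AddCommGroup S.Lim := inferInstanceAs (AddCommGroup S.union)
instance (S : Scale A) : Module ℂ S.Lim := inferInstanceAs (Module ℂ S.union)

/-- The inclusion of the inductive limit into `A`. -/
def val (S : Scale A) : S.Lim →ₗ[ℂ] A := S.union.subtype

/-- The inclusion of the `r`-th space into the inductive limit. -/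
def incl (S : Scale A) (r : Set.Ioi (0 : ℝ)) : (S.extNorm r).space → S.Lim :=
  fun a => (⟨(a : A), Set.mem_iUnion_of_mem r a.2⟩ : S.union)

/-- The locally convex inductive limit topology: the finest locally convex vector space topology
on the union for which the inclusions of all the normed spaces of the scale are continuous.
(The infimum in Mathlib's order on topologies is the coarsest topology that is finer than all
members of the set; it belongs to the set itself.) -/
instance (S : Scale A) : TopologicalSpace S.Lim :=
  sInf {t | @IsTopologicalAddGroup S.Lim t _ ∧ @ContinuousSMul ℂ S.Lim _ _ t ∧
    @LocallyConvexSpace ℝ S.Lim _ _ _ _ t ∧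
    ∀ r : Set.Ioi (0 : ℝ), @Continuous _ _ (S.extNorm r).topology t (S.incl r)}

instance (S : Scale A) : IsTopologicalAddGroup S.Lim := topologicalAddGroup_sInf fun _ ht => ht.1
instance (S : Scale A) : ContinuousSMul ℂ S.Lim := continuousSMul_sInf fun _ ht => ht.2.1
instance (S : Scale A) : LocallyConvexSpace ℝ S.Lim := LocallyConvexSpace.sInf fun _ ht => ht.2.2.1

theorem continuous_incl (S : Scale A) (r : Set.Ioi (0 : ℝ)) :
    @Continuous _ _ (S.extNorm r).topology _ (S.incl r) :=
  continuous_sInf_rng.2 fun _ ht => ht.2.2.2 r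

/-- The unions of two scales are the same subset of `A`, and the identity is an isomorphism of
topological vector spaces for the two inductive limit topologies. -/
def SameLimit (S S' : Scale A) : Prop :=
  (S.union : Set A) = S'.union ∧ ∃ e : S.Lim ≃L[ℂ] S'.Lim, ∀ x, S'.val (e x) = S.val x

end Scale

end IndLim

/-! ### Automorphism groups and their generators -/

/-- A uniformly bounded `d`-parameter group of automorphisms of `A`. -/
structure AutGroup (d : ℕ) (A : Type*) [NormedRing A] [NormedAlgebra ℂ A] where
  aut : (Fin d → ℝ) → (A ≃ₐ[ℂ] A)
  aut_add : ∀ s t a, aut (s + t) a = aut s (aut t a)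
  bounded : ∃ C : ℝ, ∀ t a, ‖aut t a‖ ≤ C * ‖a‖

section Group

variable {d : ℕ} {A : Type*} [NormedRing A] [NormedAlgebra ℂ A] (ψ : AutGroup d A)

/-- Periodicity with respect to the lattice `ℤ^d`. -/
def AutGroup.IsPeriodic : Prop :=
  ∀ (t : Fin d → ℝ) (j : Fin d), ψ.aut (t + Pi.single j 1) = ψ.aut t

/-- The subspace `C(A)` of continuous elements. -/
def contElements : Submodule ℂ A where
  carrier := {a | Tendsto (fun t => ψ.aut t a) (𝓝 0) (𝓝 a)}
  add_mem' {a b} ha hb := by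
    have h : Tendsto (fun t => ψ.aut t a + ψ.aut t b) (𝓝 0) (𝓝 (a + b)) := ha.add hb
    simpa using h
  zero_mem' := by simp
  smul_mem' c a ha := by
    have h : Tendsto (fun t => c • ψ.aut t a) (𝓝 0) (𝓝 (c • a)) := ha.const_smul c
    simpa using h

theorem continuous_orbit {a : A} (ha : a ∈ contElements ψ) : Continuous fun t => ψ.aut t a := by
  obtain ⟨C, hC⟩ := ψ.bounded
  refine continuous_iff_continuousAt.2 fun s => ?_
  have h0 : Tendsto (fun t => ψ.aut (t - s) a) (𝓝 s) (𝓝 a) := by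
    have h1 : Tendsto (fun t : Fin d → ℝ => t - s) (𝓝 s) (𝓝 0) := by
      have := (continuous_sub_right s).tendsto s
      simpa using this
    exact Tendsto.comp (show Tendsto (fun t => ψ.aut t a) (𝓝 0) (𝓝 a) from ha) h1
  have h2 : Tendsto (fun t => C * ‖ψ.aut (t - s) a - a‖) (𝓝 s) (𝓝 0) := by
    have := (tendsto_iff_norm_sub_tendsto_zero.1 h0).const_mul C
    simpa using this
  refine tendsto_iff_norm_sub_tendsto_zero.2 (squeeze_zero (fun _ => norm_nonneg _) (fun t => ?_) h2)
  have h3 : ψ.aut t a - ψ.aut s a = ψ.aut s (ψ.aut (t - s) a - a) := by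
    rw [map_sub, ← ψ.aut_add]
    simp
  rw [h3]
  exact hC _ _

/-- The Fourier coefficient `∫_{[0,1]^d} ψ_t(a) e^{-2πi k·t} dt` (meant for `a ∈ C(A)`). -/
def fourierCoef (k : Fin d → ℤ) (a : A) : A :=
  ∫ t in Set.Icc (0 : Fin d → ℝ) 1,
    Complex.exp (-2 * Real.pi * Complex.I * ∑ i, (k i : ℂ) * (t i : ℂ)) • ψ.aut t a

theorem integrableOn_fourier (k : Fin d → ℤ) {a : A} (ha : a ∈ contElements ψ) :
    IntegrableOn (fun t : Fin d → ℝ =>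
      Complex.exp (-2 * Real.pi * Complex.I * ∑ i, (k i : ℂ) * (t i : ℂ)) • ψ.aut t a)
      (Set.Icc 0 1) := by
  refine ContinuousOn.integrableOn_compact isCompact_Icc (Continuous.continuousOn ?_)
  refine Continuous.smul (by fun_prop) (continuous_orbit ψ ha)

theorem fourierCoef_add (k : Fin d → ℤ) {a b : A} (ha : a ∈ contElements ψ)
    (hb : b ∈ contElements ψ) :
    fourierCoef ψ k (a + b) = fourierCoef ψ k a + fourierCoef ψ k b := by
  unfold fourierCoef
  rw [← integral_add (integrableOn_fourier ψ k ha) (integrableOn_fourier ψ k hb)]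
  simp only [map_add, smul_add]

theorem fourierCoef_smul (k : Fin d → ℤ) (c : ℂ) (a : A) :
    fourierCoef ψ k (c • a) = c • fourierCoef ψ k a := by
  unfold fourierCoef
  rw [← integral_smul]
  simp only [map_smul, smul_comm c]

/-- The domain of the generator `δ_j`: those `a` for which `(ψ_{h e_j}(a) - a) / h` converges as
`h → 0`. -/
def genDomain (j : Fin d) : Set A :=
  {a | DifferentiableAt ℝ (fun h : ℝ => ψ.aut (h • Pi.single j 1) a) 0}

/-- The generator `δ_j(a) = lim_{h → 0} (ψ_{h e_j}(a) - a) / h`, for `a` in its domain. -/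
def gen (j : Fin d) (a : A) : A :=
  deriv (fun h : ℝ => ψ.aut (h • Pi.single j 1) a) 0

/-- The operator `δ_{j_n} ⋯ δ_{j_1}` for the word `[j_1, …, j_n]`. -/
def genWord : List (Fin d) → A → A
  | [], a => a
  | j :: w, a => genWord w (gen ψ j a)

/-- The domain of `genWord`, defined inductively: the domain of `δ_{j_1}` as an operator in the
domain of `δ_{j_n} ⋯ δ_{j_2}`. -/
def wordDomain : List (Fin d) → Set A
  | [] => Set.univ
  | j :: w => {a | a ∈ wordDomain w ∧ a ∈ genDomain ψ j ∧ gen ψ j a ∈ wordDomain w}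

theorem gen_add {j : Fin d} {a b : A} (ha : a ∈ genDomain ψ j) (hb : b ∈ genDomain ψ j) :
    a + b ∈ genDomain ψ j ∧ gen ψ j (a + b) = gen ψ j a + gen ψ j b := by
  have ha' : HasDerivAt (fun h : ℝ => ψ.aut (h • Pi.single j 1) a) (gen ψ j a) 0 :=
    DifferentiableAt.hasDerivAt ha
  have hb' : HasDerivAt (fun h : ℝ => ψ.aut (h • Pi.single j 1) b) (gen ψ j b) 0 :=
    DifferentiableAt.hasDerivAt hb
  have h : HasDerivAt (fun h : ℝ => ψ.aut (h • Pi.single j 1) (a + b))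
      (gen ψ j a + gen ψ j b) 0 := by
    simp only [map_add]
    exact ha'.add hb'
  exact ⟨h.differentiableAt, h.deriv⟩

theorem gen_smul {j : Fin d} (c : ℂ) {a : A} (ha : a ∈ genDomain ψ j) :
    c • a ∈ genDomain ψ j ∧ gen ψ j (c • a) = c • gen ψ j a := by
  have ha' : HasDerivAt (fun h : ℝ => ψ.aut (h • Pi.single j 1) a) (gen ψ j a) 0 :=
    DifferentiableAt.hasDerivAt ha
  have h : HasDerivAt (fun h : ℝ => ψ.aut (h • Pi.single j 1) (c • a))
      (c • gen ψ j a) 0 := by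
    simp only [map_smul]
    exact ha'.const_smul c
  exact ⟨h.differentiableAt, h.deriv⟩

theorem gen_zero (j : Fin d) : (0 : A) ∈ genDomain ψ j ∧ gen ψ j (0 : A) = 0 := by
  simp [genDomain, gen]

theorem word_add (w : List (Fin d)) : ∀ {a b : A}, a ∈ wordDomain ψ w → b ∈ wordDomain ψ w →
    a + b ∈ wordDomain ψ w ∧ genWord ψ w (a + b) = genWord ψ w a + genWord ψ w b := by
  induction w with
  | nil => intro a b _ _; exact ⟨trivial, rfl⟩
  | cons j w ih =>
    rintro a b ⟨ha, ha1, ha2⟩ ⟨hb, hb1, hb2⟩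
    obtain ⟨h1, h2⟩ := gen_add ψ ha1 hb1
    obtain ⟨h3, h4⟩ := ih ha2 hb2
    exact ⟨⟨(ih ha hb).1, h1, h2 ▸ h3⟩, by simp only [genWord, h2, h4]⟩

theorem word_smul (w : List (Fin d)) (c : ℂ) : ∀ {a : A}, a ∈ wordDomain ψ w →
    c • a ∈ wordDomain ψ w ∧ genWord ψ w (c • a) = c • genWord ψ w a := by
  induction w with
  | nil => intro a _; exact ⟨trivial, rfl⟩
  | cons j w ih =>
    rintro a ⟨ha, ha1, ha2⟩
    obtain ⟨h1, h2⟩ := gen_smul ψ c ha1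
    obtain ⟨h3, h4⟩ := ih ha2
    exact ⟨⟨(ih ha).1, h1, h2 ▸ h3⟩, by simp only [genWord, h2, h4]⟩

theorem word_zero (w : List (Fin d)) : (0 : A) ∈ wordDomain ψ w ∧ genWord ψ w (0 : A) = 0 := by
  induction w with
  | nil => exact ⟨trivial, rfl⟩
  | cons j w ih =>
    obtain ⟨h1, h2⟩ := gen_zero ψ j
    exact ⟨⟨ih.1, h1, by rw [h2]; exact ih.1⟩, by simp only [genWord, h2, ih.2]⟩

/-- `C^∞(A)`: the elements on which all products of generators are defined. -/
def smoothElements : Submodule ℂ A where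
  carrier := {a | ∀ w, a ∈ wordDomain ψ w}
  add_mem' ha hb w := (word_add ψ w (ha w) (hb w)).1
  zero_mem' w := (word_zero ψ w).1
  smul_mem' c _ ha w := (word_smul ψ w c (ha w)).1

/-- The word in which the letter `j` occurs `α j` times. -/
def multiWord (α : Fin d → ℕ) : List (Fin d) :=
  (List.finRange d).flatMap fun j => List.replicate (α j) j

/-- `δ^α = ∏ δ_j^{α_j}` (the generators commute). -/
def multiGen (α : Fin d → ℕ) (a : A) : A := genWord ψ (multiWord α) a

/-- The space of `σ`-bandlimited elements: all `a ∈ C^∞(A)` with Bernstein's inequality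
`‖δ^α(a)‖ ≤ C (2πσ)^{|α|}` for all multi-indices `α`. -/
def bandlimited (σ : ℝ) : Submodule ℂ A where
  carrier := {a | a ∈ smoothElements ψ ∧
    ∃ C : ℝ, ∀ α : Fin d → ℕ, ‖multiGen ψ α a‖ ≤ C * (2 * Real.pi * σ) ^ (∑ i, α i)}
  add_mem' := by
    rintro a b ⟨ha, C, hC⟩ ⟨hb, D, hD⟩
    refine ⟨Submodule.add_mem _ ha hb, C + D, fun α => ?_⟩
    have h : multiGen ψ α (a + b) = multiGen ψ α a + multiGen ψ α b := (word_add ψ _ (ha _) (hb _)).2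
    rw [h, add_mul]
    exact (norm_add_le _ _).trans (add_le_add (hC α) (hD α))
  zero_mem' := by
    refine ⟨Submodule.zero_mem _, 0, fun α => ?_⟩
    have h : multiGen ψ α (0 : A) = 0 := (word_zero ψ _).2
    simp [h]
  smul_mem' := by
    rintro c a ⟨ha, C, hC⟩
    refine ⟨Submodule.smul_mem _ c ha, ‖c‖ * C, fun α => ?_⟩
    have h : multiGen ψ α (c • a) = c • multiGen ψ α a := (word_smul ψ _ c (ha _)).2
    rw [h, norm_smul, mul_assoc]
    exact mul_le_mul_of_nonneg_left (hC α) (norm_nonneg _)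

/-- The approximation scheme of bandlimited elements: `X_0 = {0}`, and `X_n` consists of the
`n`-bandlimited elements for `n ≥ 1`. -/
def blScheme : ℕ → Submodule ℂ A
  | 0 => ⊥
  | n + 1 => bandlimited ψ ((n : ℝ) + 1)

end Group

/-! ### The spaces -/

/-- The function associated to `M`, `T_M(u) = sup_k u^k / M_k`, with values in `[0, ∞]`. -/
def assocFun (M : ℕ → ℝ) (u : ℝ) : ℝ≥0∞ := ⨆ k : ℕ, ENNReal.ofReal (u ^ k / M k)

theorem assocFun_mono {M : ℕ → ℝ} (hM : ∀ k, 0 < M k) {u v : ℝ} (hu : 0 ≤ u) (huv : u ≤ v) :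
    assocFun M u ≤ assocFun M v :=
  iSup_mono fun k => ENNReal.ofReal_le_ofReal
    (div_le_div_of_nonneg_right (pow_le_pow_left₀ hu huv k) (hM k).le)

/-- Komatsu's condition (M2'). -/
def KomatsuM2' (M : ℕ → ℝ) : Prop :=
  ∃ c > (0 : ℝ), ∃ h > (1 : ℝ), ∀ k : ℕ, M (k + 1) ≤ c * h ^ k * M k

/-- A defining sequence: a sequence of positive numbers with `M_0 = 1`. -/
structure DefSeq where
  seq : ℕ → ℝ
  pos : ∀ k, 0 < seq k
  zero : seq 0 = 1

section Spaces

variable {d : ℕ} {A : Type*} [NormedRing A] [NormedAlgebra ℂ A] (ψ : AutGroup d A)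

open Classical in
/-- The extended norm of `C_{r,M}(A)`: `sup_α ‖δ^α(a)‖ / (r^{|α|} M_{|α|})` on `C^∞(A)`, and `∞`
for the other elements. -/
def carlemanNorm (M : ℕ → ℝ) (r : ℝ) : ExtNorm A where
  toFun a := if a ∈ smoothElements ψ then
    ⨆ α : Fin d → ℕ, ‖multiGen ψ α a‖ₑ / ENNReal.ofReal (r ^ (∑ i, α i) * M (∑ i, α i)) else ∞
  add_le a b := by
    by_cases ha : a ∈ smoothElements ψ
    · by_cases hb : b ∈ smoothElements ψ
      · rw [if_pos ha, if_pos hb, if_pos (Submodule.add_mem _ ha hb)]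
        refine iSup_le fun α => ?_
        have h : multiGen ψ α (a + b) = multiGen ψ α a + multiGen ψ α b :=
          (word_add ψ _ (ha _) (hb _)).2
        rw [h]
        refine (ENNReal.div_le_div_right (enorm_add_le _ _) _).trans ?_
        rw [ENNReal.add_div]
        exact add_le_add
          (le_iSup (fun α => ‖multiGen ψ α a‖ₑ / ENNReal.ofReal (r ^ (∑ i, α i) * M (∑ i, α i))) α)
          (le_iSup (fun α => ‖multiGen ψ α b‖ₑ / ENNReal.ofReal (r ^ (∑ i, α i) * M (∑ i, α i))) α)
      · simp [hb]
    · simp [ha]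
  smul_le c a := by
    by_cases ha : a ∈ smoothElements ψ
    · rw [if_pos ha, if_pos (Submodule.smul_mem _ c ha), ENNReal.mul_iSup]
      refine iSup_mono fun α => ?_
      have h : multiGen ψ α (c • a) = c • multiGen ψ α a := (word_smul ψ _ c (ha _)).2
      rw [h, enorm_smul, mul_div_assoc]
    · by_cases hc : c = 0
      · subst hc
        have h (α : Fin d → ℕ) : multiGen ψ α (0 : A) = 0 := (word_zero ψ _).2
        simp [h]
      · simp [ha, hc]

open Classical in
/-- The extended norm of the weighted space `C^1_v(A)`: `∑_k ‖â(k)‖ v(k)` on `C(A)`, and `∞` for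
the other elements, which have no Fourier coefficients. -/
def weightedOneNorm (v : (Fin d → ℤ) → ℝ≥0∞) : ExtNorm A where
  toFun a := if a ∈ contElements ψ then ∑' k, ‖fourierCoef ψ k a‖ₑ * v k else ∞
  add_le a b := by
    by_cases ha : a ∈ contElements ψ
    · by_cases hb : b ∈ contElements ψ
      · rw [if_pos ha, if_pos hb, if_pos (Submodule.add_mem _ ha hb), ← ENNReal.tsum_add]
        refine ENNReal.tsum_le_tsum fun k => ?_
        rw [fourierCoef_add ψ k ha hb, ← add_mul]
        exact mul_le_mul_left (enorm_add_le _ _) _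
      · simp [hb]
    · simp [ha]
  smul_le c a := by
    by_cases ha : a ∈ contElements ψ
    · rw [if_pos ha, if_pos (Submodule.smul_mem _ c ha), ← ENNReal.tsum_mul_left]
      simp only [fourierCoef_smul, enorm_smul, mul_assoc, le_refl]
    · by_cases hc : c = 0
      · subst hc
        simp [fourierCoef]
      · simp [ha, hc]

open Classical in
/-- The extended norm of the weighted space `C^∞_v(A)`: `sup_k ‖â(k)‖ v(k)` on `C(A)`, and `∞` for
the other elements, which have no Fourier coefficients. -/
def weightedSupNorm (v : (Fin d → ℤ) → ℝ≥0∞) : ExtNorm A where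
  toFun a := if a ∈ contElements ψ then ⨆ k, ‖fourierCoef ψ k a‖ₑ * v k else ∞
  add_le a b := by
    by_cases ha : a ∈ contElements ψ
    · by_cases hb : b ∈ contElements ψ
      · rw [if_pos ha, if_pos hb, if_pos (Submodule.add_mem _ ha hb)]
        refine iSup_le fun k => ?_
        rw [fourierCoef_add ψ k ha hb]
        refine (mul_le_mul_left (enorm_add_le _ _) _).trans ?_
        rw [add_mul]
        exact add_le_add (le_iSup (fun k => ‖fourierCoef ψ k a‖ₑ * v k) k)
          (le_iSup (fun k => ‖fourierCoef ψ k b‖ₑ * v k) k)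
      · simp [hb]
    · simp [ha]
  smul_le c a := by
    by_cases ha : a ∈ contElements ψ
    · rw [if_pos ha, if_pos (Submodule.smul_mem _ c ha), ENNReal.mul_iSup]
      simp only [fourierCoef_smul, enorm_smul, mul_assoc, le_refl]
    · by_cases hc : c = 0
      · subst hc
        simp [fourierCoef]
      · simp [ha, hc]

/-- The approximation error `E_n(a) = inf_{x ∈ X_n} ‖a - x‖`. -/
def approxError (X : ℕ → Submodule ℂ A) (n : ℕ) (a : A) : ℝ≥0∞ := ⨅ x ∈ X n, ‖a - x‖ₑ

theorem approxError_add (X : ℕ → Submodule ℂ A) (n : ℕ) (a b : A) :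
    approxError X n (a + b) ≤ approxError X n a + approxError X n b := by
  unfold approxError
  simp only [ENNReal.iInf_add, ENNReal.add_iInf]
  refine le_iInf₂ fun x hx => le_iInf₂ fun y hy => ?_
  refine (iInf₂_le (y + x) (Submodule.add_mem _ hy hx)).trans ?_
  rw [show a + b - (y + x) = (a - y) + (b - x) by abel]
  exact enorm_add_le (a - y) (b - x)

theorem approxError_smul (X : ℕ → Submodule ℂ A) (n : ℕ) (c : ℂ) (a : A) :
    approxError X n (c • a) ≤ ‖c‖ₑ * approxError X n a := by
  by_cases hc : c = 0
  · subst hc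
    refine (iInf₂_le 0 (Submodule.zero_mem _)).trans ?_
    simp
  · unfold approxError
    have hc0 : ‖c‖ₑ ≠ 0 := by simpa using hc
    have hct : ‖c‖ₑ ≠ ∞ := enorm_ne_top (x := c)
    simp only [ENNReal.mul_iInf_of_ne hc0 hct]
    refine le_iInf₂ fun x hx => (iInf₂_le (c • x) (Submodule.smul_mem _ c hx)).trans ?_
    rw [← smul_sub, enorm_smul]

/-- The extended norm of the approximation space `E^∞_w(A)` of the scheme `X`:
`sup_n E_n(a) w(n)`. -/
def approxNorm (X : ℕ → Submodule ℂ A) (w : ℕ → ℝ≥0∞) : ExtNorm A where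
  toFun a := ⨆ n, approxError X n a * w n
  add_le a b := by
    refine iSup_le fun n => ?_
    refine (mul_le_mul_left (approxError_add X n a b) _).trans ?_
    rw [add_mul]
    exact add_le_add (le_iSup (fun n => approxError X n a * w n) n)
      (le_iSup (fun n => approxError X n b * w n) n)
  smul_le c a := by
    rw [ENNReal.mul_iSup]
    refine iSup_mono fun n => ?_
    rw [← mul_assoc]
    exact mul_le_mul_left (approxError_smul X n c a) _

/-- The weight `T_{r,M}(k) = T_M(2π |k|_∞ / r)` on `ℤ^d` (`‖k‖` is the maximum norm). -/
def latticeWeight (M : ℕ → ℝ) (r : ℝ) (k : Fin d → ℤ) : ℝ≥0∞ :=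
  assocFun M (2 * Real.pi * ‖k‖ / r)

/-- The weight `T_{r,M}(n) = T_M(2π n / r)` on `ℕ`. -/
def natWeight (M : ℕ → ℝ) (r : ℝ) (n : ℕ) : ℝ≥0∞ :=
  assocFun M (2 * Real.pi * n / r)

theorem latticeWeight_anti (M : DefSeq) {r s : ℝ} (hr : 0 < r) (hrs : r ≤ s) (k : Fin d → ℤ) :
    latticeWeight M.seq s k ≤ latticeWeight M.seq r k := by
  have hs := hr.trans_le hrs
  exact assocFun_mono M.pos (by positivity)
    (div_le_div_of_nonneg_left (by positivity) hr hrs)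

theorem natWeight_anti (M : DefSeq) {r s : ℝ} (hr : 0 < r) (hrs : r ≤ s) (n : ℕ) :
    natWeight M.seq s n ≤ natWeight M.seq r n := by
  have hs := hr.trans_le hrs
  exact assocFun_mono M.pos (by positivity)
    (div_le_div_of_nonneg_left (by positivity) hr hrs)

/-- The spaces `C_{r,M}(A)`, `r > 0`; their inductive limit is the Carleman class `C_M(A)`. -/
def carlemanScale (M : DefSeq) : Scale A where
  extNorm r := carlemanNorm ψ M.seq r
  anti r s hr hrs a := by
    by_cases ha : a ∈ smoothElements ψ
    · simp only [carlemanNorm, if_pos ha]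
      refine iSup_mono fun α => ENNReal.div_le_div_left (ENNReal.ofReal_le_ofReal ?_) _
      exact mul_le_mul_of_nonneg_right (pow_le_pow_left₀ hr.le hrs _) (M.pos _).le
    · simp [carlemanNorm, ha]

/-- The spaces `C^1_{T_{r,M}}(A)`, `r > 0`. -/
def weightedOneScale (M : DefSeq) : Scale A where
  extNorm r := weightedOneNorm ψ (latticeWeight M.seq r)
  anti r s hr hrs a := by
    by_cases ha : a ∈ contElements ψ
    · simp only [weightedOneNorm, if_pos ha]
      exact ENNReal.tsum_le_tsum fun k => mul_le_mul_right (latticeWeight_anti M hr hrs k) _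
    · simp [weightedOneNorm, ha]

/-- The spaces `C^∞_{T_{r,M}}(A)`, `r > 0`. -/
def weightedSupScale (M : DefSeq) : Scale A where
  extNorm r := weightedSupNorm ψ (latticeWeight M.seq r)
  anti r s hr hrs a := by
    by_cases ha : a ∈ contElements ψ
    · simp only [weightedSupNorm, if_pos ha]
      exact iSup_mono fun k => mul_le_mul_right (latticeWeight_anti M hr hrs k) _
    · simp [weightedSupNorm, ha]

/-- The spaces `E^∞_{T_{r,M}}(A)`, `r > 0`, for the scheme of bandlimited elements. -/
def approxScale (M : DefSeq) : Scale A where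
  extNorm r := approxNorm (blScheme ψ) (natWeight M.seq r)
  anti _ _ hr hrs _ :=
    iSup_mono fun n => mul_le_mul_right (natWeight_anti M hr hrs n) _

end Spaces

end Carleman

end

open Carleman

/-!
The four scales of spaces are compared through Fourier series. Write `e_k(t) = e^{2πi k·t}`, and
call `b` spectral of frequency `k` if `ψ_t(b) = e_k(t) b` for all `t`. The Fourier coefficients
`â(k)` of a continuous element are spectral (`isSpectral_fourierCoef`), because integrals of
lattice periodic functions over the unit cube are invariant under translations, and they are
bounded by a multiple of `‖a‖`.

* If `a` is smooth, then `(δ^α a)^(k) = (2πi k)^α â(k)`. With `α` in the direction of a largest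
  coordinate of `k` this bounds `(2π|k|)^n ‖â(k)‖` by `‖δ^α a‖` for all `n`, and the supremum over
  `n` bounds `‖â(k)‖ T_{r,M}(k)` (`carlemanScale_dominatedBy_weightedSupScale`).
* Under (M2') every power of `|k|` times `T_{s,M}(k)` is bounded by `T_{r,M}(k)` if `s` is a large
  multiple of `r`. Hence the supremum norm for `r` bounds the `ℓ¹`-norm for `s`
  (`weightedSupScale_dominatedBy_weightedOneScale`).
* If the weighted `ℓ¹`-norm of `a` is finite, then `a = ∑ â(k)` absolutely (`hasSum_fourierCoef`).
  A series of spectral elements is differentiated term by term, and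
  `(2π|k|)^n ≤ r^n M_n T_{r,M}(k)` gives the bound for `δ^α a` (`carlemanNorm_tsum_le`).
* Truncated Fourier series are bandlimited, which bounds the approximation errors by tails of the
  `ℓ¹`-norm (`weightedOneScale_dominatedBy_approxScale`). Conversely, an `n`-bandlimited element has
  no frequencies beyond `n`, so that `‖â(k)‖` is bounded by the approximation error of any order
  below `|k|` (`approxScale_dominatedBy_weightedSupScale`).

All these inclusions are bounded, up to a change of the radius, and mutual domination of two scales
makes the identity an isomorphism of the inductive limits (`Scale.sameLimit_of_dominatedBy`).

The product of two elements of a weighted `ℓ¹`-space is the double series of the spectral elements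
`â(j) b̂(k)`, of frequency `j + k`. As `T_{2r,M}(j + k) ≤ T_{r,M}(j) T_{r,M}(k)`, it belongs to the
Carleman class, so that this class is an algebra (`exists_subalgebra_eq_union`).
-/

namespace Carleman

/-! ### Lattice periodic functions -/

section Torus

variable {d : ℕ} {E : Type*}

/-- Periodicity of a function on `ℝ^d` with respect to the lattice `ℤ^d`. -/
def LatticePeriodic (f : (Fin d → ℝ) → E) : Prop :=
  ∀ (t : Fin d → ℝ) (n : Fin d → ℤ), f (t + fun i => (n i : ℝ)) = f t

/-- The projection of `ℝ^d` onto the torus `(ℝ/ℤ)^d`. -/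
def torusMk (t : Fin d → ℝ) : UnitAddTorus (Fin d) := fun i => (t i : UnitAddCircle)

theorem torusMk_def (t : Fin d → ℝ) : torusMk t = fun i => (t i : UnitAddCircle) := rfl

theorem isOpenQuotientMap_torusMk : IsOpenQuotientMap (torusMk (d := d)) :=
  IsOpenQuotientMap.piMap fun _ => QuotientAddGroup.isOpenQuotientMap_mk

theorem LatticePeriodic.eq_of_torusMk_eq {f : (Fin d → ℝ) → E} (hf : LatticePeriodic f)
    {s t : Fin d → ℝ} (h : torusMk s = torusMk t) : f s = f t := by
  have h1 : ∀ i, ∃ n : ℤ, (n : ℝ) = -s i + t i := fun i => by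
    obtain ⟨n, hn⟩ := QuotientAddGroup.eq.1 (congrFun h i)
    exact ⟨n, by simpa using hn⟩
  choose n hn using h1
  rw [← hf s n]
  congr 1
  ext i
  simp [hn]

theorem LatticePeriodic.exists_lift {f : (Fin d → ℝ) → E} (hf : LatticePeriodic f) :
    ∃ F : UnitAddTorus (Fin d) → E, ∀ t, F (torusMk t) = f t :=
  ⟨fun x => f (Function.surjInv isOpenQuotientMap_torusMk.surjective x), fun _ =>
    hf.eq_of_torusMk_eq (Function.surjInv_eq isOpenQuotientMap_torusMk.surjective _)⟩

variable [NormedAddCommGroup E] [NormedSpace ℂ E]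

/-- The closed cube and the half-open cube used for integration over the torus differ by a null
set. -/
theorem setIntegral_Icc_eq_Ioc (f : (Fin d → ℝ) → E) (s : Fin d → ℝ) :
    ∫ t in Set.Icc s (s + 1), f t = ∫ t in {x | ∀ i, x i ∈ Set.Ioc (s i) (s i + 1)}, f t := by
  have h : {x : Fin d → ℝ | ∀ i, x i ∈ Set.Ioc (s i) (s i + 1)} =
      Set.pi Set.univ fun i => Set.Ioc (s i) ((s + 1) i) := by
    ext x; simp
  rw [h]
  exact setIntegral_congr_set Measure.univ_pi_Ioc_ae_eq_Icc.symm

theorem LatticePeriodic.setIntegral_cube_add {f : (Fin d → ℝ) → E} (hf : LatticePeriodic f)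
    (s : Fin d → ℝ) :
    ∫ t in Set.Icc (0 : Fin d → ℝ) 1, f (t + s) = ∫ t in Set.Icc (0 : Fin d → ℝ) 1, f t := by
  obtain ⟨F, hF⟩ := hf.exists_lift
  have h1 := (measurePreserving_add_right (volume : Measure (Fin d → ℝ)) s).setIntegral_preimage_emb
    (measurableEmbedding_addRight s) f (Set.Icc s (s + 1))
  have h2 : (fun t => t + s) ⁻¹' Set.Icc s (s + 1) = Set.Icc (0 : Fin d → ℝ) 1 := by
    rw [Set.preimage_add_const_Icc]; simp
  rw [h2] at h1
  rw [h1, setIntegral_Icc_eq_Ioc, show (1 : Fin d → ℝ) = 0 + 1 by simp, setIntegral_Icc_eq_Ioc]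
  have h3 := (UnitAddTorus.integral_preimage F s).symm.trans (UnitAddTorus.integral_preimage F 0)
  simpa only [← torusMk_def, hF] using h3

/-- The character `t ↦ e^{2πi k·t}` of `ℝ^d` with frequency `k ∈ ℤ^d`. -/
noncomputable def latticeChar (k : Fin d → ℤ) (t : Fin d → ℝ) : ℂ :=
  Complex.exp (2 * Real.pi * Complex.I * ∑ i, (k i : ℂ) * (t i : ℂ))

theorem norm_latticeChar (k : Fin d → ℤ) (t : Fin d → ℝ) : ‖latticeChar k t‖ = 1 := by
  have h : 2 * Real.pi * Complex.I * ∑ i, (k i : ℂ) * (t i : ℂ) =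
      ((2 * Real.pi * ∑ i, (k i : ℝ) * t i : ℝ) : ℂ) * Complex.I := by
    push_cast; ring
  rw [latticeChar, h, Complex.norm_exp_ofReal_mul_I]

theorem latticeChar_add (k : Fin d → ℤ) (s t : Fin d → ℝ) :
    latticeChar k (s + t) = latticeChar k s * latticeChar k t := by
  simp only [latticeChar, ← Complex.exp_add, ← mul_add, ← Finset.sum_add_distrib, Pi.add_apply,
    Complex.ofReal_add]

theorem latticeChar_add_left (k l : Fin d → ℤ) (t : Fin d → ℝ) :
    latticeChar (k + l) t = latticeChar k t * latticeChar l t := by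
  simp only [latticeChar, ← Complex.exp_add, ← mul_add, ← Finset.sum_add_distrib, Pi.add_apply,
    Int.cast_add, add_mul]

@[simp] theorem latticeChar_zero (k : Fin d → ℤ) : latticeChar k 0 = 1 := by
  simp [latticeChar]

@[simp] theorem latticeChar_zero_left (t : Fin d → ℝ) : latticeChar 0 t = 1 := by
  simp [latticeChar]

theorem latticeChar_int (k n : Fin d → ℤ) : latticeChar k (fun i => (n i : ℝ)) = 1 := by
  rw [latticeChar, Complex.exp_eq_one_iff]
  exact ⟨∑ i, k i * n i, by push_cast; ring⟩

theorem mFourier_torusMk (k : Fin d → ℤ) (t : Fin d → ℝ) :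
    UnitAddTorus.mFourier k (torusMk t) = latticeChar k t := by
  simp only [UnitAddTorus.mFourier, ContinuousMap.coe_mk, torusMk, fourier_coe_apply, latticeChar,
    ← Complex.exp_sum, Finset.mul_sum]
  congr 1
  refine Finset.sum_congr rfl fun i _ => ?_
  push_cast; ring

theorem latticeChar_neg_left (k : Fin d → ℤ) (t : Fin d → ℝ) :
    latticeChar (-k) t = latticeChar k (-t) := by
  simp [latticeChar]

/-- A continuous lattice periodic function with absolutely summable Fourier coefficients is, at the
origin, the sum of its Fourier coefficients. -/
theorem LatticePeriodic.hasSum_fourier {f : (Fin d → ℝ) → ℂ} (hf : LatticePeriodic f)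
    (hc : Continuous f)
    (hs : Summable fun k : Fin d → ℤ =>
      ∫ t in Set.Icc (0 : Fin d → ℝ) 1, latticeChar k (-t) * f t) :
    HasSum (fun k : Fin d → ℤ => ∫ t in Set.Icc (0 : Fin d → ℝ) 1, latticeChar k (-t) * f t)
      (f 0) := by
  obtain ⟨F, hF⟩ := hf.exists_lift
  have hFc : Continuous F := by
    rw [isOpenQuotientMap_torusMk.isQuotientMap.continuous_iff]
    exact hc.congr fun t => (hF t).symm
  have h1 : ∀ k : Fin d → ℤ, UnitAddTorus.mFourierCoeff F k =
      ∫ t in Set.Icc (0 : Fin d → ℝ) 1, latticeChar k (-t) * f t := fun k => by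
    rw [UnitAddTorus.mFourierCoeff_eq_integral F k 0, show (1 : Fin d → ℝ) = 0 + 1 by simp,
      setIntegral_Icc_eq_Ioc]
    simp only [← torusMk_def, hF, mFourier_torusMk, latticeChar_neg_left, smul_eq_mul]
  simp only [← h1] at hs ⊢
  have h2 := UnitAddTorus.hasSum_mFourier_series_apply_of_summable (f := ⟨F, hFc⟩) hs (torusMk 0)
  simpa [mFourier_torusMk, hF] using h2

end Torus

/-! ### Fourier coefficients of continuous elements -/

section Fourier

variable {d : ℕ} {A : Type*} [NormedRing A] [NormedAlgebra ℂ A] (ψ : AutGroup d A)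

theorem aut_zero (a : A) : ψ.aut 0 a = a :=
  (ψ.aut 0).injective (by rw [← ψ.aut_add, add_zero])

theorem aut_comm (s t : Fin d → ℝ) (a : A) : ψ.aut s (ψ.aut t a) = ψ.aut t (ψ.aut s a) := by
  rw [← ψ.aut_add, ← ψ.aut_add, add_comm]

theorem exists_aut_bound : ∃ C : ℝ, 0 < C ∧ ∀ t a, ‖ψ.aut t a‖ ≤ C * ‖a‖ := by
  obtain ⟨C, hC⟩ := ψ.bounded
  exact ⟨max C 1, by positivity, fun t a => (hC t a).trans
    (mul_le_mul_of_nonneg_right (le_max_left _ _) (norm_nonneg _))⟩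

/-- The automorphism `ψ_t` as a continuous linear map. -/
noncomputable def autCLM (t : Fin d → ℝ) : A →L[ℂ] A :=
  (ψ.aut t).toLinearMap.mkContinuousOfExistsBound (ψ.bounded.imp fun _ h => h t)

@[simp] theorem autCLM_apply (t : Fin d → ℝ) (a : A) : autCLM ψ t a = ψ.aut t a := rfl

variable {ψ}

theorem AutGroup.IsPeriodic.latticePeriodic (hψ : ψ.IsPeriodic) (a : A) :
    LatticePeriodic fun t => ψ.aut t a := by
  -- The periods of `ψ` form a group, which contains the standard basis of `ℤ^d`.
  let P : AddSubgroup (Fin d → ℝ) :=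
    { carrier := {v | ∀ t, ψ.aut (t + v) = ψ.aut t}
      zero_mem' := fun t => by rw [add_zero]
      add_mem' := fun {v w} hv hw t => by rw [← add_assoc, hw, hv]
      neg_mem' := fun {v} hv t => by
        have h := hv (t + -v)
        rw [neg_add_cancel_right] at h
        exact h.symm }
  have h : ∀ n : Fin d → ℤ, (fun i => (n i : ℝ)) ∈ P := fun n => by
    have h1 : (fun i => (n i : ℝ)) = ∑ j, n j • (Pi.single j 1 : Fin d → ℝ) := by
      ext i
      simp [Finset.sum_apply, Pi.single_apply]
    rw [h1]
    exact P.sum_mem fun j _ => P.zsmul_mem (fun t => hψ t j) _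
  intro t n
  simp only [h n t]

theorem fourierCoef_eq (k : Fin d → ℤ) (a : A) :
    fourierCoef ψ k a = ∫ t in Set.Icc (0 : Fin d → ℝ) 1, latticeChar k (-t) • ψ.aut t a := by
  simp [fourierCoef, latticeChar]

theorem integrableOn_latticeChar_smul (k : Fin d → ℤ) {a : A} (ha : a ∈ contElements ψ) :
    IntegrableOn (fun t : Fin d → ℝ => latticeChar k (-t) • ψ.aut t a) (Set.Icc 0 1) := by
  simpa [latticeChar] using integrableOn_fourier ψ k ha

theorem norm_fourierCoef_le {C : ℝ} (hC : ∀ t a, ‖ψ.aut t a‖ ≤ C * ‖a‖) (k : Fin d → ℤ) (a : A) :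
    ‖fourierCoef ψ k a‖ ≤ C * ‖a‖ := by
  rw [fourierCoef_eq]
  have h := norm_setIntegral_le_of_norm_le_const (μ := (volume : Measure (Fin d → ℝ)))
    (s := Set.Icc (0 : Fin d → ℝ) 1) (f := fun t => latticeChar k (-t) • ψ.aut t a)
    (C := C * ‖a‖) isCompact_Icc.measure_lt_top (fun t _ => by
      rw [norm_smul, norm_latticeChar, one_mul]; exact hC t a)
  simpa [Measure.real, Real.volume_Icc_pi] using h

theorem fourierCoef_sub (k : Fin d → ℤ) {a b : A} (ha : a ∈ contElements ψ)
    (hb : b ∈ contElements ψ) :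
    fourierCoef ψ k (a - b) = fourierCoef ψ k a - fourierCoef ψ k b := by
  rw [sub_eq_add_neg, ← neg_one_smul ℂ b, fourierCoef_add ψ k ha (Submodule.smul_mem _ _ hb),
    fourierCoef_smul, neg_one_smul, sub_eq_add_neg]

theorem fourierCoef_aut (hψ : ψ.IsPeriodic) (k : Fin d → ℤ) (s : Fin d → ℝ) (a : A) :
    fourierCoef ψ k (ψ.aut s a) = latticeChar k s • fourierCoef ψ k a := by
  have hp : LatticePeriodic fun t => latticeChar k (-t) • ψ.aut t a := fun t n => by
    have h1 : -(t + fun i => (n i : ℝ)) = -t + fun i => (((-n) i : ℤ) : ℝ) := by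
      ext i; simp; ring
    simp only [h1, latticeChar_add, latticeChar_int, mul_one, hψ.latticePeriodic a t n]
  rw [fourierCoef_eq, fourierCoef_eq, ← hp.setIntegral_cube_add s, ← integral_smul]
  congr 1
  ext t
  rw [smul_smul, ← latticeChar_add, ψ.aut_add, neg_add, add_neg_cancel_comm_assoc]

/-- `b` is a spectral element of frequency `k`: `ψ_t(b) = e^{2πi k·t} b` for all `t`. -/
def IsSpectral (ψ : AutGroup d A) (k : Fin d → ℤ) (b : A) : Prop :=
  ∀ t, ψ.aut t b = latticeChar k t • b

variable [CompleteSpace A]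

theorem isSpectral_fourierCoef (hψ : ψ.IsPeriodic) (k : Fin d → ℤ) {a : A}
    (ha : a ∈ contElements ψ) : IsSpectral ψ k (fourierCoef ψ k a) := fun s => by
  have h1 := (autCLM ψ s).integral_comp_comm (integrableOn_latticeChar_smul k ha)
  rw [← fourierCoef_aut hψ, fourierCoef_eq, fourierCoef_eq]
  simpa [aut_comm ψ s] using h1.symm

/-- Elements with absolutely summable Fourier coefficients are the sums of their Fourier series.
This is tested on continuous functionals, where it is the corresponding fact about continuous
functions on the torus. -/
theorem hasSum_fourierCoef (hψ : ψ.IsPeriodic) {a : A} (ha : a ∈ contElements ψ)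
    (hs : Summable fun k => ‖fourierCoef ψ k a‖) : HasSum (fun k => fourierCoef ψ k a) a := by
  have h1 : HasSum (fun k => fourierCoef ψ k a) (∑' k, fourierCoef ψ k a) := hs.of_norm.hasSum
  convert h1
  refine (SeparatingDual.eq_iff_forall_dual_eq (R := ℂ)).2 fun g => ?_
  have h2 : HasSum (fun k => g (fourierCoef ψ k a)) (g (∑' k, fourierCoef ψ k a)) := g.hasSum h1
  have h3 : ∀ k, g (fourierCoef ψ k a) =
      ∫ t in Set.Icc (0 : Fin d → ℝ) 1, latticeChar k (-t) * g (ψ.aut t a) := fun k => by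
    rw [fourierCoef_eq, ← g.integral_comp_comm (integrableOn_latticeChar_smul k ha)]
    simp
  have hp : LatticePeriodic fun t => g (ψ.aut t a) := fun t n => by
    simp only [hψ.latticePeriodic a t n]
  simp only [h3] at h2
  have h4 := hp.hasSum_fourier (g.continuous.comp (continuous_orbit ψ ha)) h2.summable
  simpa only [aut_zero] using h4.unique h2

end Fourier

/-! ### Fourier coefficients and generators -/

section Generators

variable {d : ℕ} {A : Type*} [NormedRing A] [NormedAlgebra ℂ A] {ψ : AutGroup d A}

theorem isClosed_contElements : IsClosed (contElements ψ : Set A) := by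
  obtain ⟨C, hC0, hC⟩ := exists_aut_bound ψ
  refine isClosed_of_closure_subset fun a ha => ?_
  change Tendsto (fun t => ψ.aut t a) (𝓝 0) (𝓝 a)
  rw [Metric.tendsto_nhds]
  intro ε hε
  obtain ⟨b, hb, hab⟩ := Metric.mem_closure_iff.1 ha (ε / (2 * (C + 1))) (by positivity)
  have hb' : Tendsto (fun t => ψ.aut t b) (𝓝 0) (𝓝 b) := hb
  filter_upwards [Metric.tendsto_nhds.1 hb' (ε / 2) (by positivity)] with t ht
  rw [dist_eq_norm] at hab ht ⊢
  have h1 : ψ.aut t a - a = ψ.aut t (a - b) + (ψ.aut t b - b) - (a - b) := by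
    rw [map_sub]; abel
  have h2 : (C + 1) * ‖a - b‖ < ε / 2 := by
    rw [lt_div_iff₀ (by positivity)] at hab
    linarith
  rw [h1]
  have h3 := norm_sub_le (ψ.aut t (a - b) + (ψ.aut t b - b)) (a - b)
  have h4 := norm_add_le (ψ.aut t (a - b)) (ψ.aut t b - b)
  have h5 := hC t (a - b)
  linarith

theorem hasDerivAt_gen {j : Fin d} {a : A} (ha : a ∈ genDomain ψ j) :
    HasDerivAt (fun h : ℝ => ψ.aut (h • Pi.single j 1) a) (gen ψ j a) 0 :=
  DifferentiableAt.hasDerivAt ha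

/-- Continuity in each coordinate direction gives joint continuity, since the automorphisms are
uniformly bounded. -/
theorem mem_contElements_of_forall_genDomain {a : A} (ha : ∀ j, a ∈ genDomain ψ j) :
    a ∈ contElements ψ := by
  obtain ⟨C, hC0, hC⟩ := exists_aut_bound ψ
  have h1 : ∀ s : Finset (Fin d),
      Tendsto (fun t : Fin d → ℝ => ψ.aut (∑ j ∈ s, t j • Pi.single j 1) a) (𝓝 0) (𝓝 a) := by
    intro s
    induction s using Finset.induction_on with
    | empty => simp [aut_zero]
    | insert j s hj ih =>
      have h2 : Tendsto (fun t : Fin d → ℝ => ψ.aut (t j • Pi.single j 1) a) (𝓝 0) (𝓝 a) := by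
        have h3 := (hasDerivAt_gen (ha j)).continuousAt.tendsto
        simp only [zero_smul, aut_zero] at h3
        exact h3.comp ((continuous_apply j).tendsto' _ _ rfl)
      rw [tendsto_iff_norm_sub_tendsto_zero] at h2 ih ⊢
      have h4 := (ih.const_mul C).add h2
      simp only [mul_zero, add_zero] at h4
      refine squeeze_zero (fun _ => norm_nonneg _) (fun t => ?_) h4
      rw [Finset.sum_insert hj, ψ.aut_add]
      have h5 : ψ.aut (t j • Pi.single j 1) (ψ.aut (∑ j ∈ s, t j • Pi.single j 1) a) - a =
          ψ.aut (t j • Pi.single j 1) (ψ.aut (∑ j ∈ s, t j • Pi.single j 1) a - a) +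
            (ψ.aut (t j • Pi.single j 1) a - a) := by
        rw [map_sub]; abel
      rw [h5]
      exact (norm_add_le _ _).trans (add_le_add_left (hC _ _) _)
  have h6 := h1 Finset.univ
  have h7 : ∀ t : Fin d → ℝ, ∑ j, t j • (Pi.single j 1 : Fin d → ℝ) = t := fun t => by
    ext i; simp [Finset.sum_apply, Pi.single_apply]
  simp only [h7] at h6
  exact h6

theorem smoothElements_le_contElements : smoothElements ψ ≤ contElements ψ := fun _ ha =>
  mem_contElements_of_forall_genDomain fun j => (ha [j]).2.1

theorem gen_mem_smoothElements {a : A} (ha : a ∈ smoothElements ψ) (j : Fin d) :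
    gen ψ j a ∈ smoothElements ψ := fun w => (ha (j :: w)).2.2

theorem hasDerivAt_latticeChar (k : Fin d → ℤ) (j : Fin d) (x : ℝ) :
    HasDerivAt (fun h : ℝ => latticeChar k (h • Pi.single j 1))
      (2 * Real.pi * Complex.I * k j * latticeChar k (x • Pi.single j 1)) x := by
  have h1 : ∀ h : ℝ, latticeChar k (h • Pi.single j 1) =
      Complex.exp (2 * Real.pi * Complex.I * k j * h) := fun h => by
    simp [latticeChar, Pi.single_apply, apply_ite Complex.ofReal, mul_assoc]
  simp only [h1]
  have h2 : HasDerivAt (fun h : ℝ => 2 * Real.pi * Complex.I * k j * (h : ℂ))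
      (2 * Real.pi * Complex.I * k j) x := by
    simpa using (Complex.ofRealCLM.hasDerivAt (x := x)).const_mul (2 * Real.pi * Complex.I * k j)
  rw [mul_comm (2 * Real.pi * Complex.I * (k j : ℂ))]
  exact h2.cexp

theorem fourierCoef_gen (hψ : ψ.IsPeriodic) (k : Fin d → ℤ) (j : Fin d) {a : A}
    (ha : a ∈ contElements ψ) (hj : a ∈ genDomain ψ j) (hg : gen ψ j a ∈ contElements ψ) :
    fourierCoef ψ k (gen ψ j a) = (2 * Real.pi * Complex.I * k j) • fourierCoef ψ k a := by
  obtain ⟨C, hC0, hC⟩ := exists_aut_bound ψ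
  have hc : ∀ s, ψ.aut s a ∈ contElements ψ := fun s => by
    change Tendsto (fun t => ψ.aut t (ψ.aut s a)) (𝓝 0) (𝓝 (ψ.aut s a))
    simp only [aut_comm ψ _ s]
    exact ((autCLM ψ s).continuous.tendsto a).comp ha
  -- `a ↦ â(k)` is linear and bounded on the continuous elements, hence it respects derivatives.
  have h1 : HasDerivAt (fun h : ℝ => fourierCoef ψ k (ψ.aut (h • Pi.single j 1) a))
      (fourierCoef ψ k (gen ψ j a)) 0 := by
    have h2 := hasDerivAt_gen hj
    rw [hasDerivAt_iff_isLittleO] at h2 ⊢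
    refine Asymptotics.IsBigO.trans_isLittleO (Asymptotics.IsBigO.of_bound C ?_) h2
    filter_upwards with h
    rw [← Complex.coe_smul, ← Complex.coe_smul, ← fourierCoef_smul,
      ← fourierCoef_sub k (hc _) (hc _),
      ← fourierCoef_sub k (Submodule.sub_mem _ (hc _) (hc _)) (Submodule.smul_mem _ _ hg)]
    exact norm_fourierCoef_le hC k _
  simp only [fourierCoef_aut hψ] at h1
  have h3 := (hasDerivAt_latticeChar k j 0).smul_const (fourierCoef ψ k a)
  simpa using h1.unique h3

/-- The factor `∏ 2πi k_j` over the letters `j` of the word `w`, by which `genWord w` multiplies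
elements of frequency `k`. -/
noncomputable def wordSymbol (k : Fin d → ℤ) (w : List (Fin d)) : ℂ :=
  (w.map fun j => 2 * Real.pi * Complex.I * (k j : ℂ)).prod

theorem wordSymbol_cons (k : Fin d → ℤ) (j : Fin d) (w : List (Fin d)) :
    wordSymbol k (j :: w) = 2 * Real.pi * Complex.I * (k j : ℂ) * wordSymbol k w := by
  simp [wordSymbol]

theorem fourierCoef_genWord (hψ : ψ.IsPeriodic) (k : Fin d → ℤ) (w : List (Fin d)) :
    ∀ {a : A}, a ∈ smoothElements ψ →
      fourierCoef ψ k (genWord ψ w a) = wordSymbol k w • fourierCoef ψ k a := by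
  induction w with
  | nil => intro a _; simp [genWord, wordSymbol]
  | cons j w ih =>
    intro a ha
    have hg := gen_mem_smoothElements ha j
    rw [genWord, ih hg, fourierCoef_gen hψ k j (smoothElements_le_contElements ha) (ha [j]).2.1
      (smoothElements_le_contElements hg), smul_smul, wordSymbol_cons, mul_comm]

theorem norm_symbol_factor (k : Fin d → ℤ) (j : Fin d) :
    ‖2 * Real.pi * Complex.I * (k j : ℂ)‖ = 2 * Real.pi * ‖k j‖ := by
  simp [abs_of_pos Real.pi_pos, Int.norm_eq_abs]

theorem norm_wordSymbol_le (k : Fin d → ℤ) (w : List (Fin d)) :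
    ‖wordSymbol k w‖ ≤ (2 * Real.pi * ‖k‖) ^ w.length := by
  induction w with
  | nil => simp [wordSymbol]
  | cons j w ih =>
    rw [wordSymbol_cons, norm_mul, List.length_cons, pow_succ', norm_symbol_factor]
    gcongr
    exact norm_le_pi_norm k j

theorem length_multiWord (α : Fin d → ℕ) : (multiWord α).length = ∑ i, α i := by
  simp [multiWord, List.length_flatMap, Fin.sum_univ_def]

theorem wordSymbol_multiWord (k : Fin d → ℤ) (α : Fin d → ℕ) :
    wordSymbol k (multiWord α) = ∏ j, (2 * Real.pi * Complex.I * (k j : ℂ)) ^ α j := by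
  simp [wordSymbol, multiWord, List.flatMap_def, List.prod_flatten, Fin.prod_univ_def,
    Function.comp_def]

end Generators

/-! ### Weights -/

section Weights

variable {d : ℕ} (M : DefSeq)

theorem le_assocFun (u : ℝ) (n : ℕ) : ENNReal.ofReal (u ^ n / M.seq n) ≤ assocFun M.seq u :=
  le_iSup (fun k => ENNReal.ofReal (u ^ k / M.seq k)) n

theorem one_le_assocFun (u : ℝ) : 1 ≤ assocFun M.seq u := by
  simpa [M.zero] using le_assocFun M u 0

theorem assocFun_zero : assocFun M.seq 0 = 1 := by
  refine le_antisymm (iSup_le fun k => ?_) (one_le_assocFun M 0)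
  rcases Nat.eq_zero_or_pos k with rfl | hk
  · simp [M.zero]
  · simp [hk.ne']

theorem one_le_latticeWeight (r : ℝ) (k : Fin d → ℤ) : 1 ≤ latticeWeight M.seq r k :=
  one_le_assocFun M _

theorem pow_norm_le_mul_latticeWeight {r : ℝ} (hr : 0 < r) (k : Fin d → ℤ) (n : ℕ) :
    ENNReal.ofReal ((2 * Real.pi * ‖k‖) ^ n) ≤
      ENNReal.ofReal (r ^ n * M.seq n) * latticeWeight M.seq r k := by
  have hM := M.pos n
  have h : (2 * Real.pi * ‖k‖) ^ n =
      r ^ n * M.seq n * ((2 * Real.pi * ‖k‖ / r) ^ n / M.seq n) := by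
    rw [div_pow]
    field_simp
  rw [h, ENNReal.ofReal_mul (by positivity)]
  exact mul_le_mul_right (le_assocFun M _ n) _

/-- Both factors are at least one, so that the larger of them suffices on the right. -/
theorem latticeWeight_add_le {r : ℝ} (hr : 0 < r) (j k : Fin d → ℤ) :
    latticeWeight M.seq (2 * r) (j + k) ≤ latticeWeight M.seq r j * latticeWeight M.seq r k := by
  have h1 : ∀ {x : Fin d → ℤ}, ‖j + k‖ ≤ 2 * ‖x‖ →
      latticeWeight M.seq (2 * r) (j + k) ≤ latticeWeight M.seq r x := fun {x} hx => by
    refine assocFun_mono M.pos (by positivity) ?_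
    rw [div_le_div_iff₀ (by positivity) hr]
    nlinarith [mul_le_mul_of_nonneg_left hx (mul_pos Real.pi_pos hr).le]
  have h2 := norm_add_le j k
  rcases le_total ‖j‖ ‖k‖ with h | h
  · exact (h1 (by linarith)).trans (le_mul_of_one_le_left' (one_le_latticeWeight M r j))
  · exact (h1 (by linarith)).trans (le_mul_of_one_le_right' (one_le_latticeWeight M r k))

/-- Under (M2'), a dilation of the argument absorbs any power: `u^m T_M(u) ≤ C T_M(h^m u)`. -/
theorem exists_pow_mul_assocFun_le {c h : ℝ} (hc : 0 < c) (hh : 1 < h)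
    (hM : ∀ k : ℕ, M.seq (k + 1) ≤ c * h ^ k * M.seq k) (m : ℕ) :
    ∃ C : ℝ, 0 < C ∧ ∀ u : ℝ, 0 ≤ u →
      ENNReal.ofReal (u ^ m) * assocFun M.seq u ≤ ENNReal.ofReal C * assocFun M.seq (h ^ m * u) := by
  have h0 : 0 < h := one_pos.trans hh
  have step : ∀ u : ℝ, 0 ≤ u →
      ENNReal.ofReal u * assocFun M.seq u ≤ ENNReal.ofReal (c / h) * assocFun M.seq (h * u) := by
    intro u hu
    conv_lhs => rw [assocFun, ENNReal.mul_iSup]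
    refine iSup_le fun k => ?_
    rw [← ENNReal.ofReal_mul hu]
    refine le_trans ?_ (mul_le_mul_right (le_assocFun M (h * u) (k + 1)) _)
    rw [← ENNReal.ofReal_mul (by positivity)]
    refine ENNReal.ofReal_le_ofReal ?_
    have hk := M.pos k
    have hk1 := M.pos (k + 1)
    have e : c / h * ((h * u) ^ (k + 1) / M.seq (k + 1)) =
        (c * h ^ k * u ^ (k + 1)) / M.seq (k + 1) := by
      rw [mul_pow, pow_succ h]
      field_simp
    rw [e, ← mul_div_assoc, ← pow_succ', div_le_div_iff₀ hk hk1]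
    calc u ^ (k + 1) * M.seq (k + 1) ≤ u ^ (k + 1) * (c * h ^ k * M.seq k) :=
          mul_le_mul_of_nonneg_left (hM k) (by positivity)
      _ = c * h ^ k * u ^ (k + 1) * M.seq k := by ring
  induction m with
  | zero => exact ⟨1, one_pos, fun u _ => by simp⟩
  | succ m ih =>
    obtain ⟨C, hC0, hC⟩ := ih
    refine ⟨C * (c / h / h ^ m), by positivity, fun u hu => ?_⟩
    have h1 := step (h ^ m * u) (by positivity)
    calc ENNReal.ofReal (u ^ (m + 1)) * assocFun M.seq u
        = ENNReal.ofReal u * (ENNReal.ofReal (u ^ m) * assocFun M.seq u) := by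
          rw [pow_succ', ENNReal.ofReal_mul hu, mul_assoc]
      _ ≤ ENNReal.ofReal u * (ENNReal.ofReal C * assocFun M.seq (h ^ m * u)) :=
          mul_le_mul_right (hC u hu) _
      _ = ENNReal.ofReal (C / h ^ m) *
            (ENNReal.ofReal (h ^ m * u) * assocFun M.seq (h ^ m * u)) := by
          rw [← mul_assoc, ← mul_assoc, ← ENNReal.ofReal_mul hu,
            ← ENNReal.ofReal_mul (by positivity)]
          congr 2
          field_simp
      _ ≤ ENNReal.ofReal (C / h ^ m) * (ENNReal.ofReal (c / h) * assocFun M.seq (h * (h ^ m * u))) :=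
          mul_le_mul_right h1 _
      _ = ENNReal.ofReal (C * (c / h / h ^ m)) * assocFun M.seq (h ^ (m + 1) * u) := by
          rw [← mul_assoc, ← ENNReal.ofReal_mul (by positivity), ← mul_assoc h, ← pow_succ']
          congr 2
          ring

/-- The lattice `ℤ^d` is embedded into `ℝ^d`, where an exponent above the rank makes the series
converge. -/
theorem exists_summable_inv_norm_pow (d : ℕ) :
    ∃ m : ℕ, m ≠ 0 ∧ Summable fun k : Fin d → ℤ => ‖k‖⁻¹ ^ m := by
  let L := Submodule.span ℤ (Set.range (Pi.basisFun ℝ (Fin d)))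
  have h1 := ZLattice.summable_norm_pow_inv L (Module.finrank ℤ L + 1) (Nat.lt_succ_self _)
  have h2 : ∀ k : Fin d → ℤ, (fun i => (k i : ℝ)) ∈ L := fun k => by
    have h3 : (fun i => (k i : ℝ)) = ∑ j, k j • Pi.basisFun ℝ (Fin d) j := by
      ext i
      simp [Finset.sum_apply, Pi.single_apply]
    rw [h3]
    exact Submodule.sum_mem _ fun j _ =>
      Submodule.smul_mem _ _ (Submodule.subset_span (Set.mem_range_self j))
  have h4 : Function.Injective fun k : Fin d → ℤ => (⟨fun i => (k i : ℝ), h2 k⟩ : L) := by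
    intro k l hkl
    ext i
    have := congrFun (congrArg Subtype.val hkl) i
    simpa using this
  refine ⟨Module.finrank ℤ L + 1, Nat.succ_ne_zero _, (h1.comp_injective h4).congr fun k => ?_⟩
  have h5 : ‖fun i => (k i : ℝ)‖ = ‖k‖ := by
    simp only [Pi.norm_def]
    exact congrArg _ (Finset.sup_congr rfl fun i _ => NNReal.eq (Int.norm_cast_real (k i)))
  simp [h5]

/-- Under (M2'), the weight for a larger radius is smaller by a summable factor. -/
theorem exists_summable_latticeWeight_le (hM : KomatsuM2' M.seq) {r : ℝ} (hr : 0 < r) :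
    ∃ s > 0, ∃ g : (Fin d → ℤ) → ℝ≥0∞, ∑' k, g k ≠ ∞ ∧
      ∀ k, latticeWeight M.seq s k ≤ g k * latticeWeight M.seq r k := by
  obtain ⟨c, hc, h, hh, hM⟩ := hM
  obtain ⟨m, hm, hs⟩ := exists_summable_inv_norm_pow d
  obtain ⟨C, hC0, hC⟩ := exists_pow_mul_assocFun_le M hc hh hM m
  have h0 : 0 < h := one_pos.trans hh
  have hs0 : 0 < h ^ m * r := by positivity
  set s := h ^ m * r with hs_def
  have hpi := Real.pi_pos
  -- The second summand is the value at `k = 0`, where both weights are `1` and `‖k‖⁻¹ = 0`.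
  refine ⟨s, hs0, fun k => ENNReal.ofReal (C * (s / (2 * Real.pi)) ^ m * ‖k‖⁻¹ ^ m) +
    if k = 0 then 1 else 0, ?_, fun k => ?_⟩
  · rw [ENNReal.tsum_add, tsum_ite_eq]
    exact ENNReal.add_ne_top.2 ⟨(hs.mul_left _).tsum_ofReal_ne_top, ENNReal.one_ne_top⟩
  · by_cases hk : k = 0
    · subst hk
      simp [latticeWeight, assocFun_zero, hm]
    · have hk0 : 0 < ‖k‖ := norm_pos_iff.2 hk
      have h1 := hC (2 * Real.pi * ‖k‖ / s) (by positivity)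
      have h2 : h ^ m * (2 * Real.pi * ‖k‖ / s) = 2 * Real.pi * ‖k‖ / r := by
        rw [hs_def]; field_simp
      rw [h2] at h1
      simp only [if_neg hk, add_zero]
      have hu : 0 < 2 * Real.pi * ‖k‖ / s := by positivity
      have h3 : C * (s / (2 * Real.pi)) ^ m * ‖k‖⁻¹ ^ m =
          ((2 * Real.pi * ‖k‖ / s) ^ m)⁻¹ * C := by
        rw [mul_assoc, ← mul_pow, ← inv_pow, mul_comm C]
        congr 2
        field_simp
      rw [h3, ENNReal.ofReal_mul (by positivity), mul_assoc]
      refine le_trans ?_ (mul_le_mul_right h1 _)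
      rw [← mul_assoc, ← ENNReal.ofReal_mul (by positivity), inv_mul_cancel₀ (by positivity),
        ENNReal.ofReal_one, one_mul]
      rfl

end Weights

/-! ### Series of spectral elements -/

section Series

variable {d : ℕ} {A : Type*} [NormedRing A] [NormedAlgebra ℂ A] {ψ : AutGroup d A}

theorem IsSpectral.smul {k : Fin d → ℤ} {b : A} (hb : IsSpectral ψ k b) (c : ℂ) :
    IsSpectral ψ k (c • b) := fun t => by
  rw [map_smul, hb t, smul_comm]

theorem IsSpectral.mul {k l : Fin d → ℤ} {a b : A} (ha : IsSpectral ψ k a)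
    (hb : IsSpectral ψ l b) : IsSpectral ψ (k + l) (a * b) := fun t => by
  rw [map_mul, ha t, hb t, smul_mul_smul_comm, latticeChar_add_left]

theorem isSpectral_one : IsSpectral ψ 0 (1 : A) := fun t => by simp

variable {ι : Type*} {κ : ι → Fin d → ℤ}

theorem norm_symbol_factor_smul_le (k : Fin d → ℤ) (j : Fin d) (b : A) :
    ‖(2 * Real.pi * Complex.I * (k j : ℂ)) • b‖ ≤ 2 * Real.pi * (‖k‖ * ‖b‖) := by
  rw [norm_smul, norm_symbol_factor, mul_assoc]
  gcongr
  exact norm_le_pi_norm k j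

theorem summable_pow_symbol_factor_smul {b : ι → A}
    (hs : ∀ n : ℕ, Summable fun i => ‖κ i‖ ^ n * ‖b i‖) (j : Fin d) (n : ℕ) :
    Summable fun i => ‖κ i‖ ^ n * ‖(2 * Real.pi * Complex.I * (κ i j : ℂ)) • b i‖ := by
  refine Summable.of_nonneg_of_le (fun i => by positivity) (fun i => ?_)
    ((hs (n + 1)).mul_left (2 * Real.pi))
  calc ‖κ i‖ ^ n * ‖(2 * Real.pi * Complex.I * (κ i j : ℂ)) • b i‖
      ≤ ‖κ i‖ ^ n * (2 * Real.pi * (‖κ i‖ * ‖b i‖)) :=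
        mul_le_mul_of_nonneg_left (norm_symbol_factor_smul_le _ _ _) (by positivity)
    _ = 2 * Real.pi * (‖κ i‖ ^ (n + 1) * ‖b i‖) := by ring

theorem enorm_wordSymbol_smul_le (k : Fin d → ℤ) (w : List (Fin d)) (b : A) :
    ‖wordSymbol k w • b‖ₑ ≤ ENNReal.ofReal ((2 * Real.pi * ‖k‖) ^ w.length) * ‖b‖ₑ := by
  rw [enorm_smul, ← ofReal_norm (wordSymbol k w)]
  exact mul_le_mul_left (ENNReal.ofReal_le_ofReal (norm_wordSymbol_le k w)) _

variable [CompleteSpace A]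

theorem gen_tsum {b : ι → A} (hb : ∀ i, IsSpectral ψ (κ i) (b i))
    (hs : ∀ n : ℕ, Summable fun i => ‖κ i‖ ^ n * ‖b i‖) (j : Fin d) :
    ∑' i, b i ∈ genDomain ψ j ∧
      gen ψ j (∑' i, b i) = ∑' i, (2 * Real.pi * Complex.I * (κ i j : ℂ)) • b i := by
  have h0 : Summable b := Summable.of_norm (by simpa using hs 0)
  have h1 : ∀ t, ψ.aut t (∑' i, b i) = ∑' i, latticeChar (κ i) t • b i := fun t => by
    have := (autCLM ψ t).map_tsum h0
    simpa only [autCLM_apply, (hb _) t] using this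
  have h2 : HasDerivAt (fun h : ℝ => ψ.aut (h • Pi.single j 1) (∑' i, b i))
      (∑' i, (2 * Real.pi * Complex.I * (κ i j : ℂ)) • b i) 0 := by
    simp only [h1]
    have h3 := hasDerivAt_tsum (𝕜 := ℝ) (y₀ := 0)
      (u := fun i => 2 * Real.pi * (‖κ i‖ * ‖b i‖))
      (g := fun i h => latticeChar (κ i) (h • Pi.single j 1) • b i)
      (g' := fun i h => (2 * Real.pi * Complex.I * (κ i j : ℂ) *
        latticeChar (κ i) (h • Pi.single j 1)) • b i)
      (by simpa using (hs 1).mul_left (2 * Real.pi))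
      (fun i y => (hasDerivAt_latticeChar (κ i) j y).smul_const (b i))
      (fun i y => by
        have := norm_symbol_factor_smul_le (κ i) j (b i)
        rw [norm_smul] at this ⊢
        rwa [norm_mul, norm_latticeChar, mul_one])
      (by simpa using h0) 0
    simpa using h3
  exact ⟨h2.differentiableAt, h2.deriv⟩

/-- A series of spectral elements with rapidly decreasing norms can be differentiated term by
term. -/
theorem genWord_tsum (w : List (Fin d)) : ∀ {b : ι → A}, (∀ i, IsSpectral ψ (κ i) (b i)) →
    (∀ n : ℕ, Summable fun i => ‖κ i‖ ^ n * ‖b i‖) →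
    ∑' i, b i ∈ wordDomain ψ w ∧
      genWord ψ w (∑' i, b i) = ∑' i, wordSymbol (κ i) w • b i := by
  induction w with
  | nil => intro b _ _; exact ⟨trivial, by simp [genWord, wordSymbol]⟩
  | cons j w ih =>
    intro b hb hs
    obtain ⟨h1, h2⟩ := gen_tsum hb hs j
    have hb' : ∀ i, IsSpectral ψ (κ i) ((2 * Real.pi * Complex.I * (κ i j : ℂ)) • b i) :=
      fun i => (hb i).smul _
    obtain ⟨h3, h4⟩ := ih hb' (summable_pow_symbol_factor_smul hs j)
    refine ⟨⟨(ih hb hs).1, h1, h2 ▸ h3⟩, ?_⟩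
    rw [genWord, h2, h4]
    refine tsum_congr fun i => ?_
    rw [smul_smul, wordSymbol_cons, mul_comm]

theorem tsum_mem_smoothElements {b : ι → A} (hb : ∀ i, IsSpectral ψ (κ i) (b i))
    (hs : ∀ n : ℕ, Summable fun i => ‖κ i‖ ^ n * ‖b i‖) : ∑' i, b i ∈ smoothElements ψ :=
  fun w => (genWord_tsum w hb hs).1

/-- The Carleman norm of a series of spectral elements is at most its weighted `ℓ¹`-norm, because
`(2π|k|)^n ≤ r^n M_n T_{r,M}(k)`. -/
theorem carlemanNorm_tsum_le (M : DefSeq) {r : ℝ} (hr : 0 < r) {b : ι → A}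
    (hb : ∀ i, IsSpectral ψ (κ i) (b i))
    (hs : ∑' i, ‖b i‖ₑ * latticeWeight M.seq r (κ i) ≠ ∞) :
    (carlemanNorm ψ M.seq r).toFun (∑' i, b i) ≤
      ∑' i, ‖b i‖ₑ * latticeWeight M.seq r (κ i) := by
  have hterm : ∀ (n : ℕ) i, ENNReal.ofReal ((2 * Real.pi * ‖κ i‖) ^ n) * ‖b i‖ₑ ≤
      ENNReal.ofReal (r ^ n * M.seq n) * (‖b i‖ₑ * latticeWeight M.seq r (κ i)) := fun n i => by
    rw [mul_comm ‖b i‖ₑ, ← mul_assoc]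
    exact mul_le_mul_left (pow_norm_le_mul_latticeWeight M hr _ n) _
  have hsum : ∀ n : ℕ, Summable fun i => ‖κ i‖ ^ n * ‖b i‖ := fun n => by
    -- Finiteness of the weighted sum gives all moments, since the weight dominates all powers.
    have h1 : ∑' i, ENNReal.ofReal ((2 * Real.pi * ‖κ i‖) ^ n * ‖b i‖) ≠ ∞ := by
      refine ne_top_of_le_ne_top (ENNReal.mul_ne_top (ENNReal.ofReal_ne_top (r := r ^ n * M.seq n))
        hs) ?_
      rw [← ENNReal.tsum_mul_left]
      refine ENNReal.tsum_le_tsum fun i => ?_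
      rw [ENNReal.ofReal_mul (by positivity), ofReal_norm]
      exact hterm n i
    have h2 := ENNReal.summable_toReal h1
    have h3 := h2.mul_left ((2 * Real.pi) ^ n)⁻¹
    refine h3.congr fun i => ?_
    rw [ENNReal.toReal_ofReal (by positivity), mul_pow (2 * Real.pi), mul_assoc,
      ← mul_assoc, inv_mul_cancel₀ (by positivity), one_mul]
  simp only [carlemanNorm, if_pos (tsum_mem_smoothElements hb hsum)]
  refine iSup_le fun α => ENNReal.div_le_of_le_mul' ?_
  rw [multiGen, (genWord_tsum _ hb hsum).2, ← ENNReal.tsum_mul_left]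
  refine (enorm_tsum_le_tsum_enorm).trans (ENNReal.tsum_le_tsum fun i => ?_)
  refine (enorm_wordSymbol_smul_le _ _ _).trans ?_
  rw [length_multiWord]
  exact hterm _ i

theorem IsSpectral.mem_bandlimited {k : Fin d → ℤ} {b : A} (hb : IsSpectral ψ k b) {σ : ℝ}
    (hk : ‖k‖ ≤ σ) : b ∈ bandlimited ψ σ := by
  have h1 : ∀ w, b ∈ wordDomain ψ w ∧ genWord ψ w b = wordSymbol k w • b := fun w => by
    simpa using genWord_tsum (ι := Unit) (κ := fun _ => k) w (b := fun _ => b) (fun _ => hb)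
      fun n => Summable.of_finite
  refine ⟨fun w => (h1 w).1, ‖b‖, fun α => ?_⟩
  rw [multiGen, (h1 _).2, norm_smul, mul_comm, ← length_multiWord]
  refine mul_le_mul_of_nonneg_left ((norm_wordSymbol_le _ _).trans ?_) (norm_nonneg b)
  gcongr

end Series

/-! ### Comparison of scales -/

section Domination

variable {A : Type*} [AddCommGroup A] [Module ℂ A]

/-- Every space of the scale `S` is continuously included in some space of the scale `S'`. -/
def Scale.DominatedBy (S S' : Scale A) : Prop :=
  ∀ r > 0, ∃ s > 0, ∃ C : ℝ≥0∞, C ≠ ∞ ∧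
    ∀ a, (S.extNorm r).toFun a ≠ ∞ → (S'.extNorm s).toFun a ≤ C * (S.extNorm r).toFun a

namespace Scale

variable {S S' S'' : Scale A}

theorem DominatedBy.trans (h : S.DominatedBy S') (h' : S'.DominatedBy S'') :
    S.DominatedBy S'' := fun r hr => by
  obtain ⟨s, hs, C, hC, h1⟩ := h r hr
  obtain ⟨q, hq, D, hD, h2⟩ := h' s hs
  refine ⟨q, hq, D * C, ENNReal.mul_ne_top hD hC, fun a ha => ?_⟩
  have h3 := h1 a ha
  refine (h2 a (ne_top_of_le_ne_top (ENNReal.mul_ne_top hC ha) h3)).trans ?_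
  rw [mul_assoc]
  exact mul_le_mul_right h3 D

theorem mem_union {a : A} : a ∈ S.union ↔ ∃ r > 0, (S.extNorm r).toFun a ≠ ∞ := by
  refine Set.mem_iUnion.trans ⟨?_, ?_⟩
  · rintro ⟨⟨r, hr⟩, ha⟩
    exact ⟨r, hr, LT.lt.ne ha⟩
  · rintro ⟨r, hr, ha⟩
    exact ⟨⟨r, hr⟩, Ne.lt_top ha⟩

theorem DominatedBy.union_le (h : S.DominatedBy S') : S.union ≤ S'.union := fun a ha => by
  obtain ⟨r, hr, har⟩ := mem_union.1 ha
  obtain ⟨s, hs, C, hC, h1⟩ := h r hr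
  exact mem_union.2 ⟨s, hs, ne_top_of_le_ne_top (ENNReal.mul_ne_top hC har) (h1 a har)⟩

/-- The inclusion between the inductive limits of two scales. -/
def DominatedBy.map (h : S.DominatedBy S') : S.Lim →ₗ[ℂ] S'.Lim :=
  Submodule.inclusion h.union_le

/-- The pullback of the limit topology of `S'` is one of the topologies that compete in the
definition of the limit topology of `S`, which is finer than all of them. -/
theorem DominatedBy.continuous_map (h : S.DominatedBy S') : Continuous h.map := by
  rw [continuous_iff_le_induced]
  refine sInf_le ⟨topologicalAddGroup_induced h.map, continuousSMul_induced h.map,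
    LocallyConvexSpace.induced (h.map.restrictScalars ℝ), fun r => ?_⟩
  rw [continuous_induced_rng]
  obtain ⟨s, hs, C, hC, h1⟩ := h r r.2
  have hle : ∀ a : (S.extNorm r).space, (S'.extNorm s).toFun a ≤ C * (S.extNorm r).toFun a :=
    fun a => h1 a a.2.ne
  -- The inclusion of the `r`-th space factors through the `s`-th space of the other scale.
  let f : (S.extNorm r).space →ₗ[ℂ] (S'.extNorm s).space :=
    Submodule.inclusion fun a ha =>
      (h1 a (LT.lt.ne ha)).trans_lt (ENNReal.mul_lt_top hC.lt_top ha)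
  have hf : @Continuous _ _ (S.extNorm r).topology (S'.extNorm s).topology f := by
    let _ := (S.extNorm r).norm.toSeminormedAddCommGroup
    let _ := (S'.extNorm s).norm.toSeminormedAddCommGroup
    refine AddMonoidHomClass.continuous_of_bound f C.toReal fun a => ?_
    have h2 := ENNReal.toReal_mono (ENNReal.mul_ne_top hC a.2.ne) (hle a)
    rw [ENNReal.toReal_mul] at h2
    exact h2
  exact @Continuous.comp _ _ _ (S.extNorm r).topology (S'.extNorm s).topology _ _ _
    (S'.continuous_incl ⟨s, hs⟩) hf

theorem sameLimit_of_dominatedBy (h : S.DominatedBy S') (h' : S'.DominatedBy S) :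
    S.SameLimit S' :=
  ⟨congrArg _ (le_antisymm h.union_le h'.union_le),
    { h.map with
      invFun := h'.map
      left_inv := fun _ => rfl
      right_inv := fun _ => rfl
      continuous_toFun := h.continuous_map
      continuous_invFun := h'.continuous_map }, fun _ => rfl⟩

end Scale

end Domination

/-! ### Norm estimates -/

section Comparison

variable {d : ℕ} {A : Type*} [NormedRing A] [NormedAlgebra ℂ A] {ψ : AutGroup d A}

theorem exists_norm_apply_eq {k : Fin d → ℤ} (hk : k ≠ 0) : ∃ j, ‖k j‖ = ‖k‖ := by
  obtain ⟨i, _⟩ := Function.ne_iff.1 hk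
  obtain ⟨j, _, hj⟩ := Finset.exists_mem_eq_sup Finset.univ ⟨i, Finset.mem_univ i⟩
    fun i => ‖k i‖₊
  exact ⟨j, by rw [Pi.norm_def, hj]; rfl⟩

theorem exists_norm_eq_natCast (k : Fin d → ℤ) : ∃ m : ℕ, ‖k‖ = m := by
  by_cases hk : k = 0
  · exact ⟨0, by simp [hk]⟩
  · obtain ⟨j, hj⟩ := exists_norm_apply_eq hk
    exact ⟨(k j).natAbs, by rw [← hj, Int.norm_eq_abs, ← Int.cast_abs, Int.abs_eq_natAbs]; rfl⟩

/-- Powers of one generator in the direction of a largest coordinate of `k` turn the norm of `k`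
into derivatives. -/
theorem exists_multiWord_norm_eq {k : Fin d → ℤ} {n : ℕ} (h : k ≠ 0 ∨ n = 0) :
    ∃ α : Fin d → ℕ, ∑ i, α i = n ∧
      ‖wordSymbol k (multiWord α)‖ = (2 * Real.pi * ‖k‖) ^ n := by
  by_cases hn : n = 0
  · exact ⟨0, by simp [hn], by simp [wordSymbol_multiWord, hn]⟩
  · obtain ⟨j, hj⟩ := exists_norm_apply_eq (h.resolve_right hn)
    refine ⟨Pi.single j n, by simp, ?_⟩
    rw [wordSymbol_multiWord, Finset.prod_eq_single j, Pi.single_eq_same, norm_pow,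
      norm_symbol_factor, hj]
    · intro i _ hij
      rw [Pi.single_eq_of_ne hij, pow_zero]
    · simp

theorem norm_wordSymbol_mul_norm_fourierCoef_le (hψ : ψ.IsPeriodic) {C : ℝ}
    (hC : ∀ t a, ‖ψ.aut t a‖ ≤ C * ‖a‖) (k : Fin d → ℤ) {a : A} (ha : a ∈ smoothElements ψ)
    (α : Fin d → ℕ) :
    ‖wordSymbol k (multiWord α)‖ * ‖fourierCoef ψ k a‖ ≤ C * ‖multiGen ψ α a‖ := by
  rw [← norm_smul, ← fourierCoef_genWord hψ k _ ha]
  exact norm_fourierCoef_le hC k _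

theorem enorm_le_of_norm_le {E : Type*} [SeminormedAddGroup E] {C : ℝ} (hC0 : 0 < C) {x y : E} (h : ‖x‖ ≤ C * ‖y‖) :
    ‖x‖ₑ ≤ ENNReal.ofReal C * ‖y‖ₑ := by
  rw [← ofReal_norm x, ← ofReal_norm y, ← ENNReal.ofReal_mul hC0.le]
  exact ENNReal.ofReal_le_ofReal h

theorem carlemanScale_dominatedBy_weightedSupScale (hψ : ψ.IsPeriodic) (M : DefSeq) :
    (carlemanScale ψ M).DominatedBy (weightedSupScale ψ M) := by
  intro r hr
  obtain ⟨C, hC0, hC⟩ := exists_aut_bound ψ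
  refine ⟨r, hr, ENNReal.ofReal C, ENNReal.ofReal_ne_top, fun a ha => ?_⟩
  have hsm : a ∈ smoothElements ψ := by
    by_contra h
    exact ha (if_neg h)
  simp only [carlemanScale, weightedSupScale, carlemanNorm, weightedSupNorm, if_pos hsm,
    if_pos (smoothElements_le_contElements hsm)]
  refine iSup_le fun k => ?_
  rw [latticeWeight, assocFun, ENNReal.mul_iSup]
  refine iSup_le fun n => ?_
  by_cases h : k ≠ 0 ∨ n = 0
  · obtain ⟨α, hα, hk⟩ := exists_multiWord_norm_eq h
    refine le_trans ?_ (mul_le_mul_right (le_iSup _ α) _)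
    have h1 := norm_wordSymbol_mul_norm_fourierCoef_le hψ hC k hsm α
    have hM := M.pos n
    rw [hα, ← mul_div_assoc, ENNReal.le_div_iff_mul_le
      (Or.inl (ENNReal.ofReal_pos.2 (by positivity)).ne') (Or.inl ENNReal.ofReal_ne_top),
      mul_assoc, ← ENNReal.ofReal_mul (by positivity), ← ofReal_norm, ← ofReal_norm,
      ← ENNReal.ofReal_mul (by positivity), ← ENNReal.ofReal_mul hC0.le]
    refine ENNReal.ofReal_le_ofReal ?_
    rw [hk] at h1
    refine le_trans (le_of_eq ?_) h1
    rw [div_pow]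
    field_simp
  · push Not at h
    simp [h.1, h.2]

theorem weightedSupScale_dominatedBy_weightedOneScale (M : DefSeq) (hM : KomatsuM2' M.seq) :
    (weightedSupScale ψ M).DominatedBy (weightedOneScale ψ M) := by
  intro r hr
  obtain ⟨s, hs, g, hg, hgs⟩ := exists_summable_latticeWeight_le (d := d) M hM hr
  refine ⟨s, hs, ∑' k, g k, hg, fun a ha => ?_⟩
  have hc : a ∈ contElements ψ := by
    by_contra h
    exact ha (if_neg h)
  simp only [weightedSupScale, weightedOneScale, weightedSupNorm, weightedOneNorm, if_pos hc]
  rw [← ENNReal.tsum_mul_right]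
  refine ENNReal.tsum_le_tsum fun k => ?_
  calc ‖fourierCoef ψ k a‖ₑ * latticeWeight M.seq s k
      ≤ ‖fourierCoef ψ k a‖ₑ * (g k * latticeWeight M.seq r k) := mul_le_mul_right (hgs k) _
    _ = g k * (‖fourierCoef ψ k a‖ₑ * latticeWeight M.seq r k) := mul_left_comm _ _ _
    _ ≤ _ := mul_le_mul_right
      (le_iSup (fun k => ‖fourierCoef ψ k a‖ₑ * latticeWeight M.seq r k) k) _

theorem weightedOneNorm_ne_top {v : (Fin d → ℤ) → ℝ≥0∞} {a : A}
    (ha : (weightedOneNorm ψ v).toFun a ≠ ∞) :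
    a ∈ contElements ψ ∧ (weightedOneNorm ψ v).toFun a = ∑' k, ‖fourierCoef ψ k a‖ₑ * v k := by
  by_cases h : a ∈ contElements ψ
  · exact ⟨h, if_pos h⟩
  · exact absurd (if_neg h) ha

/-! ### Approximation by bandlimited elements -/

/-- Bernstein's inequality confines the spectrum of a bandlimited element. -/
theorem fourierCoef_eq_zero_of_mem_bandlimited (hψ : ψ.IsPeriodic) {σ : ℝ} (hσ : 0 ≤ σ)
    {k : Fin d → ℤ} (hk : σ < ‖k‖) {x : A} (hx : x ∈ bandlimited ψ σ) :
    fourierCoef ψ k x = 0 := by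
  obtain ⟨C, hC0, hC⟩ := exists_aut_bound ψ
  obtain ⟨hsm, D, hD⟩ := hx
  have hk0 : 0 < ‖k‖ := hσ.trans_lt hk
  have hle : ∀ n : ℕ, ‖fourierCoef ψ k x‖ ≤ C * D * (σ / ‖k‖) ^ n := fun n => by
    obtain ⟨α, hα, h1⟩ := exists_multiWord_norm_eq (n := n) (Or.inl (norm_pos_iff.1 hk0))
    have h2 := norm_wordSymbol_mul_norm_fourierCoef_le hψ hC k hsm α
    have h3 := h2.trans (mul_le_mul_of_nonneg_left (hD α) hC0.le)
    have hpi := Real.pi_pos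
    rw [h1, hα, mul_comm, ← le_div_iff₀ (by positivity)] at h3
    refine h3.trans_eq ?_
    rw [mul_pow _ σ, mul_pow _ ‖k‖, div_pow]
    field_simp
  have h4 : Tendsto (fun n : ℕ => C * D * (σ / ‖k‖) ^ n) atTop (𝓝 0) := by
    simpa using (tendsto_pow_atTop_nhds_zero_of_lt_one (by positivity)
      ((div_lt_one hk0).2 hk)).const_mul (C * D)
  exact norm_le_zero_iff.1 (ge_of_tendsto' h4 hle)

theorem blScheme_le_smoothElements (n : ℕ) : blScheme ψ n ≤ smoothElements ψ := by
  rcases n with _ | n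
  · exact bot_le
  · exact fun x hx => hx.1

theorem enorm_fourierCoef_le_approxError (hψ : ψ.IsPeriodic) {C : ℝ} (hC0 : 0 < C)
    (hC : ∀ t a, ‖ψ.aut t a‖ ≤ C * ‖a‖) {n : ℕ} {k : Fin d → ℤ} (hn : n = 0 ∨ (n : ℝ) < ‖k‖)
    {a : A} (ha : a ∈ contElements ψ) :
    ‖fourierCoef ψ k a‖ₑ ≤ ENNReal.ofReal C * approxError (blScheme ψ) n a := by
  have h0 : ∀ x ∈ blScheme ψ n, fourierCoef ψ k x = 0 := fun x hx => by
    rcases n with _ | n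
    · rw [(Submodule.mem_bot ℂ).1 hx]
      simp [fourierCoef]
    · exact fourierCoef_eq_zero_of_mem_bandlimited hψ (by positivity)
        (by simpa using hn) hx
  rw [approxError, ENNReal.mul_iInf_of_ne (ENNReal.ofReal_pos.2 hC0).ne' ENNReal.ofReal_ne_top]
  refine le_iInf fun x => ?_
  rw [ENNReal.mul_iInf_of_ne (ENNReal.ofReal_pos.2 hC0).ne' ENNReal.ofReal_ne_top]
  refine le_iInf fun hx => ?_
  have hxc := smoothElements_le_contElements (blScheme_le_smoothElements n hx)
  have h1 := enorm_le_of_norm_le hC0 (norm_fourierCoef_le hC k (a - x))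
  rwa [fourierCoef_sub k ha hxc, h0 x hx, sub_zero] at h1

/-- Since `T_M` is unbounded, elements of an approximation space are limits of bandlimited
elements and hence continuous. -/
theorem mem_contElements_of_approxNorm_ne_top (M : DefSeq) {r : ℝ} (hr : 0 < r) {a : A}
    (ha : (approxNorm (blScheme ψ) (natWeight M.seq r)).toFun a ≠ ∞) : a ∈ contElements ψ := by
  set N := (approxNorm (blScheme ψ) (natWeight M.seq r)).toFun a with hN
  refine isClosed_contElements.closure_subset (EMetric.mem_closure_iff.2 fun ε hε => ?_)
  have hM := M.pos 1
  have h1 : Tendsto (fun n : ℕ => ENNReal.ofReal (2 * Real.pi / r / M.seq 1 * n)) atTop (𝓝 ∞) :=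
    ENNReal.tendsto_ofReal_nhds_top.2
      (tendsto_natCast_atTop_atTop.const_mul_atTop (div_pos (div_pos Real.two_pi_pos hr) hM))
  obtain ⟨n, hn⟩ := (h1.eventually_const_lt (ENNReal.div_lt_top ha hε.ne')).exists
  have h2 : ENNReal.ofReal (2 * Real.pi / r / M.seq 1 * n) ≤ natWeight M.seq r n := by
    refine le_trans (le_of_eq ?_) (le_assocFun M _ 1)
    congr 1
    rw [pow_one]
    ring
  have h3 : approxError (blScheme ψ) n a < ε := by
    by_contra hlt
    rw [ENNReal.div_lt_iff (Or.inl hε.ne') (Or.inr ha)] at hn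
    refine absurd (hn.trans_le ?_) (lt_irrefl _)
    rw [mul_comm]
    exact (mul_le_mul' (not_lt.1 hlt) h2).trans
      (le_iSup (fun n => approxError (blScheme ψ) n a * natWeight M.seq r n) n)
  obtain ⟨x, hx⟩ := iInf_lt_iff.1 h3
  obtain ⟨hxn, hx⟩ := iInf_lt_iff.1 hx
  refine ⟨x, smoothElements_le_contElements (blScheme_le_smoothElements n hxn), ?_⟩
  rwa [edist_eq_enorm_sub]

/-- A frequency `k` with `|k|_∞ ≥ 2` is controlled by the error of order `|k|_∞ - 1 ≥ |k|_∞ / 2`.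
For `|k|_∞ = 1` only the error of order `0` is available, and the lower bound on `M` provides a
radius for which the weight at `k` is `1`. -/
theorem approxScale_dominatedBy_weightedSupScale (hψ : ψ.IsPeriodic) (M : DefSeq) {ε : ℝ}
    (hε : 0 < ε) (hM : ∀ k, ε ^ k ≤ M.seq k) :
    (approxScale ψ M).DominatedBy (weightedSupScale ψ M) := by
  intro r hr
  obtain ⟨C, hC0, hC⟩ := exists_aut_bound ψ
  have hs : 0 < max (2 * r) (2 * Real.pi / ε) := lt_max_of_lt_left (by positivity)
  refine ⟨max (2 * r) (2 * Real.pi / ε), hs, ENNReal.ofReal C, ENNReal.ofReal_ne_top,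
    fun a ha => ?_⟩
  have hc := mem_contElements_of_approxNorm_ne_top M hr ha
  simp only [weightedSupScale, weightedSupNorm, if_pos hc]
  refine iSup_le fun k => ?_
  have key : ∀ n : ℕ, (n = 0 ∨ (n : ℝ) < ‖k‖) →
      latticeWeight M.seq (max (2 * r) (2 * Real.pi / ε)) k ≤ natWeight M.seq r n →
      ‖fourierCoef ψ k a‖ₑ * latticeWeight M.seq (max (2 * r) (2 * Real.pi / ε)) k ≤
        ENNReal.ofReal C * ((approxScale ψ M).extNorm r).toFun a := fun n hn hw => by
    refine (mul_le_mul' (enorm_fourierCoef_le_approxError hψ hC0 hC hn hc) hw).trans ?_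
    rw [mul_assoc]
    exact mul_le_mul_right
      (le_iSup (fun n => approxError (blScheme ψ) n a * natWeight M.seq r n) n) _
  obtain ⟨m, hm⟩ := exists_norm_eq_natCast k
  -- The coordinates are integers, so that `1 < |k|_∞` means `2 ≤ |k|_∞`.
  by_cases h1 : m ≤ 1
  · refine key 0 (Or.inl rfl) (le_trans (iSup_le fun n => ?_) (one_le_assocFun M _))
    have hm1 : (m : ℝ) ≤ 1 := by exact_mod_cast h1
    have h2 : 2 * Real.pi * ‖k‖ / max (2 * r) (2 * Real.pi / ε) ≤ ε := by
      rw [div_le_iff₀ hs, hm]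
      have h3 := mul_le_mul_of_nonneg_left (le_max_right (2 * r) (2 * Real.pi / ε)) hε.le
      rw [mul_div_cancel₀ _ hε.ne'] at h3
      nlinarith [Real.pi_pos]
    rw [ENNReal.ofReal_le_one, div_le_one (M.pos n)]
    exact (pow_le_pow_left₀ (by positivity) h2 n).trans (hM n)
  · obtain ⟨n, rfl⟩ := Nat.exists_eq_add_of_le (not_le.1 h1)
    have hk : ‖k‖ = n + 2 := by rw [hm]; push_cast; ring
    refine key (n + 1) (Or.inr (by rw [hk]; push_cast; linarith)) ?_
    refine assocFun_mono M.pos (by positivity) ?_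
    rw [hk, div_le_div_iff₀ hs hr]
    have h3 := le_max_left (2 * r) (2 * Real.pi / ε)
    have h4 : (((n + 1 : ℕ) : ℝ)) * (2 * r) ≤ ((n + 1 : ℕ) : ℝ) * max (2 * r) (2 * Real.pi / ε) :=
      mul_le_mul_of_nonneg_left h3 (by positivity)
    have h5 : ((n : ℝ) + 2) * r ≤ ((n + 1 : ℕ) : ℝ) * max (2 * r) (2 * Real.pi / ε) := by
      refine le_trans ?_ h4
      push_cast
      nlinarith [mul_nonneg (Nat.cast_nonneg (α := ℝ) n) hr.le]
    nlinarith [mul_le_mul_of_nonneg_left h5 Real.two_pi_pos.le]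

variable [CompleteSpace A]

/-- The Fourier series of an element of a weighted `ℓ¹`-space converges absolutely to it. -/
theorem hasSum_of_weightedOneNorm_ne_top (hψ : ψ.IsPeriodic) (M : DefSeq) {r : ℝ} {a : A}
    (ha : (weightedOneNorm ψ (latticeWeight M.seq r)).toFun a ≠ ∞) :
    (Summable fun k => ‖fourierCoef ψ k a‖) ∧ HasSum (fun k => fourierCoef ψ k a) a := by
  obtain ⟨hc, h1⟩ := weightedOneNorm_ne_top ha
  have hs : Summable fun k => ‖fourierCoef ψ k a‖ := by
    refine tsum_enorm_ne_top_iff_summable_norm.1 (ne_top_of_le_ne_top (h1 ▸ ha) ?_)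
    exact ENNReal.tsum_le_tsum fun k => le_mul_of_one_le_right' (one_le_latticeWeight M r k)
  exact ⟨hs, hasSum_fourierCoef hψ hc hs⟩

theorem weightedOneScale_dominatedBy_carlemanScale (hψ : ψ.IsPeriodic) (M : DefSeq) :
    (weightedOneScale ψ M).DominatedBy (carlemanScale ψ M) := by
  intro r hr
  refine ⟨r, hr, 1, ENNReal.one_ne_top, fun a ha => ?_⟩
  obtain ⟨hc, h1⟩ := weightedOneNorm_ne_top ha
  have h2 := carlemanNorm_tsum_le M hr (κ := id) (fun k => isSpectral_fourierCoef hψ k hc)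
    (h1 ▸ ha)
  rw [(hasSum_of_weightedOneNorm_ne_top hψ M ha).2.tsum_eq] at h2
  rw [one_mul]
  exact h2.trans_eq h1.symm

/-- The tail of a series, multiplied by a lower bound of the weight on the tail, is at most the
weighted sum. -/
theorem enorm_sub_sum_mul_le {ι E : Type*} [NormedAddCommGroup E] {f : ι → E} {a : E}
    (hf : HasSum f a) (F : Finset ι) {w : ι → ℝ≥0∞} {c : ℝ≥0∞} (hw : ∀ i ∉ F, c ≤ w i) :
    ‖a - ∑ i ∈ F, f i‖ₑ * c ≤ ∑' i, ‖f i‖ₑ * w i := by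
  have h1 : HasSum (fun i : {i // i ∉ F} => f i) (a - ∑ i ∈ F, f i) :=
    (F.hasSum_compl_iff (f := f)).2 (by simpa using hf)
  rw [← h1.tsum_eq]
  refine (mul_le_mul_left enorm_tsum_le_tsum_enorm _).trans ?_
  rw [← ENNReal.tsum_mul_right]
  exact (ENNReal.tsum_le_tsum fun i : {i // i ∉ F} => mul_le_mul_right (hw i i.2) _).trans
    (ENNReal.tsum_comp_le_tsum_of_injective Subtype.val_injective fun i => ‖f i‖ₑ * w i)

/-- The truncated Fourier series approximates `a` up to the sum of the remaining coefficients, on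
which the weight is at least its value at `n`. -/
theorem weightedOneScale_dominatedBy_approxScale (hψ : ψ.IsPeriodic) (M : DefSeq) :
    (weightedOneScale ψ M).DominatedBy (approxScale ψ M) := by
  intro r hr
  refine ⟨r, hr, 1, ENNReal.one_ne_top, fun a ha => ?_⟩
  obtain ⟨hc, h1⟩ := weightedOneNorm_ne_top ha
  obtain ⟨hs, hsum⟩ := hasSum_of_weightedOneNorm_ne_top hψ M ha
  -- `F` holds the retained frequencies: none for `n = 0`, as `X_0 = {0}`, and the cube of side
  -- `2n` otherwise.
  have key : ∀ (n : ℕ) (F : Finset (Fin d → ℤ)), (∀ k ∉ F, (n : ℝ) ≤ ‖k‖) →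
      ∑ k ∈ F, fourierCoef ψ k a ∈ blScheme ψ n →
      approxError (blScheme ψ) n a * natWeight M.seq r n ≤
        ∑' k, ‖fourierCoef ψ k a‖ₑ * latticeWeight M.seq r k := by
    intro n F hF hx
    refine (mul_le_mul_left (iInf₂_le _ hx) _).trans
      (enorm_sub_sum_mul_le hsum F fun k hk => assocFun_mono M.pos (by positivity) ?_)
    have := hF k hk
    gcongr
  rw [one_mul]
  refine le_trans (iSup_le fun n => ?_) h1.ge
  rcases n with _ | n
  · exact key 0 ∅ (fun k _ => by simp) (by simp)
  · refine key (n + 1) (Finset.Icc (fun _ => -((n : ℤ) + 1)) fun _ => (n : ℤ) + 1) (fun k hk => ?_)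
      (Submodule.sum_mem _ fun k hk => ?_)
    · by_contra hlt
      refine hk (Finset.mem_Icc.2 ?_)
      have h3 : ∀ i, |k i| ≤ (n : ℤ) + 1 := fun i => by
        have h4 := (norm_le_pi_norm k i).trans (not_le.1 hlt).le
        rw [Int.norm_eq_abs] at h4
        exact_mod_cast h4
      exact ⟨fun i => (abs_le.1 (h3 i)).1, fun i => (abs_le.1 (h3 i)).2⟩
    · obtain ⟨h3, h4⟩ := Finset.mem_Icc.1 hk
      refine (isSpectral_fourierCoef hψ k hc).mem_bandlimited ?_
      refine (pi_norm_le_iff_of_nonneg (by positivity)).2 fun i => ?_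
      rw [Int.norm_eq_abs]
      exact_mod_cast abs_le.2 ⟨h3 i, h4 i⟩

/-! ### Products -/

/-- The double series of products of Fourier coefficients is a series of spectral elements, and the
weights are submultiplicative up to a change of the radius. No regularity of `M` such as
logarithmic convexity is needed. -/
theorem carlemanNorm_mul_ne_top (hψ : ψ.IsPeriodic) (M : DefSeq) {r : ℝ} (hr : 0 < r) {a b : A}
    (ha : (weightedOneNorm ψ (latticeWeight M.seq r)).toFun a ≠ ∞)
    (hb : (weightedOneNorm ψ (latticeWeight M.seq r)).toFun b ≠ ∞) :
    (carlemanNorm ψ M.seq (2 * r)).toFun (a * b) ≠ ∞ := by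
  obtain ⟨hac, ha1⟩ := weightedOneNorm_ne_top ha
  obtain ⟨hbc, hb1⟩ := weightedOneNorm_ne_top hb
  obtain ⟨has, hasum⟩ := hasSum_of_weightedOneNorm_ne_top hψ M ha
  obtain ⟨hbs, hbsum⟩ := hasSum_of_weightedOneNorm_ne_top hψ M hb
  have h1 : ∑' p : (Fin d → ℤ) × (Fin d → ℤ), ‖fourierCoef ψ p.1 a * fourierCoef ψ p.2 b‖ₑ *
      latticeWeight M.seq (2 * r) (p.1 + p.2) ≠ ∞ := by
    refine ne_top_of_le_ne_top (ENNReal.mul_ne_top (ha1 ▸ ha) (hb1 ▸ hb)) ?_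
    rw [ENNReal.tsum_prod', ← ENNReal.tsum_mul_right]
    refine ENNReal.tsum_le_tsum fun j => ?_
    rw [← ENNReal.tsum_mul_left]
    refine ENNReal.tsum_le_tsum fun k => ?_
    rw [mul_mul_mul_comm]
    have h : ‖fourierCoef ψ j a * fourierCoef ψ k b‖ₑ ≤
        ‖fourierCoef ψ j a‖ₑ * ‖fourierCoef ψ k b‖ₑ := by
      simpa only [enorm, ← ENNReal.coe_mul, ENNReal.coe_le_coe] using nnnorm_mul_le _ _
    exact mul_le_mul' h (latticeWeight_add_le M hr j k)
  have h2 := carlemanNorm_tsum_le M (r := 2 * r) (by positivity)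
    (κ := fun p : (Fin d → ℤ) × (Fin d → ℤ) => p.1 + p.2)
    (fun p => (isSpectral_fourierCoef hψ p.1 hac).mul (isSpectral_fourierCoef hψ p.2 hbc)) h1
  rw [← tsum_mul_tsum_of_summable_norm has hbs, hasum.tsum_eq, hbsum.tsum_eq] at h2
  exact ne_top_of_le_ne_top h1 h2

theorem carlemanNorm_one_ne_top (M : DefSeq) {r : ℝ} (hr : 0 < r) :
    (carlemanNorm ψ M.seq r).toFun (1 : A) ≠ ∞ := by
  have h0 : latticeWeight M.seq r (0 : Fin d → ℤ) = 1 := by simp [latticeWeight, assocFun_zero]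
  have h1 : ∑' _ : Unit, ‖(1 : A)‖ₑ * latticeWeight M.seq r (0 : Fin d → ℤ) ≠ ∞ := by
    simp [h0]
  have h2 := carlemanNorm_tsum_le (ψ := ψ) M hr (κ := fun _ : Unit => 0) (b := fun _ => 1)
    (fun _ => isSpectral_one) h1
  rw [tsum_fintype] at h2
  simpa using ne_top_of_le_ne_top h1 h2

theorem exists_subalgebra_eq_union (hψ : ψ.IsPeriodic) (M : DefSeq)
    (h : (carlemanScale ψ M).DominatedBy (weightedOneScale ψ M)) :
    ∃ B : Subalgebra ℂ A, (B : Set A) = (carlemanScale ψ M).union := by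
  refine ⟨(carlemanScale ψ M).union.toSubalgebra
    (Scale.mem_union.2 ⟨1, one_pos, carlemanNorm_one_ne_top M one_pos⟩) fun a b ha hb => ?_, rfl⟩
  obtain ⟨r, hr, har⟩ := Scale.mem_union.1 (h.union_le ha)
  obtain ⟨s, hs, hbs⟩ := Scale.mem_union.1 (h.union_le hb)
  have hm : 0 < max r s := lt_max_of_lt_left hr
  exact Scale.mem_union.2 ⟨2 * max r s, by positivity, carlemanNorm_mul_ne_top hψ M hm
    (ne_top_of_le_ne_top har ((weightedOneScale ψ M).anti r _ hr (le_max_left r s) a))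
    (ne_top_of_le_ne_top hbs ((weightedOneScale ψ M).anti s _ hs (le_max_right r s) b))⟩

end Comparison

end Carleman

theorem mainTheorem2 {d : ℕ} {A : Type*} [NormedRing A] [NormedAlgebra ℂ A] [CompleteSpace A]
    (ψ : AutGroup d A) (hψ : ψ.IsPeriodic) (M : DefSeq) (hM : KomatsuM2' M.seq) :
    (∃ B : Subalgebra ℂ A, (B : Set A) = (carlemanScale ψ M).union) ∧
    (carlemanScale ψ M).SameLimit (weightedOneScale ψ M) ∧
    (carlemanScale ψ M).SameLimit (weightedSupScale ψ M) ∧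
    ((∃ ε > (0 : ℝ), ∀ k, ε ^ k ≤ M.seq k) →
      (carlemanScale ψ M).SameLimit (approxScale ψ M)) := by
  have h1 := carlemanScale_dominatedBy_weightedSupScale hψ M
  have h2 := weightedSupScale_dominatedBy_weightedOneScale (ψ := ψ) M hM
  have h3 := weightedOneScale_dominatedBy_carlemanScale hψ M
  refine ⟨exists_subalgebra_eq_union hψ M (h1.trans h2),
    Scale.sameLimit_of_dominatedBy (h1.trans h2) h3,
    Scale.sameLimit_of_dominatedBy h1 (h2.trans h3), ?_⟩
  rintro ⟨ε, hε, hMε⟩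
  exact Scale.sameLimit_of_dominatedBy
    ((h1.trans h2).trans (weightedOneScale_dominatedBy_approxScale hψ M))
    ((approxScale_dominatedBy_weightedSupScale hψ M hε hMε).trans (h2.trans h3))
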